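/- \textbf{Proposition (1-to-1 correspondence between real and complex $\omega \geq 0$ waves).} Let $\mathcal{H}$ be a complex Hilbert space, and let $M^{\mathbb{C}} = W_L\, D\, W_R$ be a complexified Maxwell-type operator on $\mathcal{H}$, that is: \begin{enumerate} \item[(a)] $D$ is a (possibly unbounded) selfadjoint operator on $\mathcal{H}$ with domain $\mathcal{D}_0$; \item[(b)] $W_L, W_R$ are bounded, selfadjoint, commuting operators on $\mathcal{H}$ with bounded inverses; \item[(c)] $W_R W_L^{-1}$ is selfadjoint and $W_R W_L^{-1} \geq c\,\mathrm{id}$ for some constant $c > 0$; \item[(d)] $M^{\mathbb{C}}$ has the domain $\mathcal{D}_R = W_R^{-1}\mathcal{D}_0$; \item[(e)] there is given an antiunitary operator $C$ on $\mathcal{H}$ with $C^2 = \mathrm{id}$ (complex conjugation) such that $C\,\mathcal{D}_R = \mathcal{D}_R$ and $C\, M^{\mathbb{C}}\, C = - M^{\mathbb{C}}$. \end{enumerate} Let $\mathcal{H}_W$ be the vector space $\mathcal{H}$ with the weighted scalar product $\langle \Phi, \Psi\rangle_W = \langle \Phi, W_L^{-1} W_R \Psi\rangle$; it is a Hilbert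 space, on which $M^{\mathbb{C}}$ is selfadjoint. Let \[ Q_{\pm} = 1_{(0,\infty)}(\pm M^{\mathbb{C}}) + \tfrac12\, 1_{\{0\}}(M^{\mathbb{C}}), \] where $1_B(A)$ denotes the spectral projection of the selfadjoint operator $A$ on $\mathcal{H}_W$ for the Borel set $B \subseteq \mathbb{R}$, and let $\mathrm{Re} = \tfrac12(\mathrm{id} + C)$. Then, for either choice of the sign, \[ 2\,\mathrm{Re}\; Q_{\pm}\, \mathrm{Re} = \mathrm{Re} : \mathcal{H}_W \longrightarrow \mathcal{H}_W . \] Moreover, $u \mapsto \Psi_\pm = Q_\pm u$ is a bijection from the set $\{u \in \mathcal{H}_W : u = \mathrm{Re}\, u\}$ of real waves onto the set $\{Q_\pm u : u = \mathrm{Re}\, u\}$ of the complex waves representing them, and its inverse is $\Psi_\pm \mapsto 2\,\mathrm{Re}\,\Psi_\pm$; in particular $u = 2\,\mathrm{Re}\,\Psi_\pm$. -/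

import Mathlib

open MeasureTheory
open scoped InnerProductSpace

noncomputable section

/-! ### Spectral calculus of unbounded operators -/

/-- A projection-valued measure on the Borel sets of `ℝ`: every `E B` is an orthogonal projection,
`E ℝ = 1`, and `E` is countably additive in the strong operator topology.
(The values on non-measurable sets are irrelevant.) -/
structure ProjectionValuedMeasure (K : Type*) [NormedAddCommGroup K] [InnerProductSpace ℂ K]
    [CompleteSpace K] where
  /-- the projection attached to a set -/
  proj : Set ℝ → K →L[ℂ] K
  isStarProjection : ∀ B, MeasurableSet B → IsStarProjection (proj B)
  proj_univ : proj Set.univ = 1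
  hasSum_iUnion : ∀ B : ℕ → Set ℝ, (∀ n, MeasurableSet (B n)) →
    Pairwise (Function.onFun Disjoint B) →
    ∀ x : K, HasSum (fun n => proj (B n) x) (proj (⋃ n, B n) x)

namespace ProjectionValuedMeasure

variable {K : Type*} [NormedAddCommGroup K] [InnerProductSpace ℂ K] [CompleteSpace K]

theorem proj_empty (E : ProjectionValuedMeasure K) (x : K) : E.proj ∅ x = 0 := by
  have h := E.hasSum_iUnion (fun _ => ∅) (fun _ => MeasurableSet.empty)
    (fun i j _ => by simp [Function.onFun]) x
  have h2 := h.summable.tendsto_atTop_zero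
  exact tendsto_nhds_unique tendsto_const_nhds h2

theorem inner_nonneg (E : ProjectionValuedMeasure K) {B : Set ℝ} (hB : MeasurableSet B) (x : K) :
    0 ≤ (⟪x, E.proj B x⟫_ℂ).re := by
  obtain ⟨h1, h2⟩ := E.isStarProjection B hB
  have h3 : E.proj B (E.proj B x) = E.proj B x := congrArg (fun T : K →L[ℂ] K => T x) h1
  have h4 : ⟪x, E.proj B x⟫_ℂ = ⟪E.proj B x, E.proj B x⟫_ℂ := by
    conv_lhs => rw [← h3]
    exact (h2.isSymmetric x (E.proj B x)).symm
  rw [h4]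
  exact inner_self_nonneg (𝕜 := ℂ) (x := E.proj B x)

/-- The scalar spectral measure `B ↦ ⟪x, E(B) x⟫` of the vector `x`. -/
def scalarMeasure (E : ProjectionValuedMeasure K) (x : K) : Measure ℝ :=
  Measure.ofMeasurable (fun B _ => ENNReal.ofReal (⟪x, E.proj B x⟫_ℂ).re)
    (by simp [E.proj_empty x])
    (by
      intro B hB hd
      have h := E.hasSum_iUnion B hB hd x
      have h2 : HasSum (fun n => (⟪x, E.proj (B n) x⟫_ℂ).re)
          (⟪x, E.proj (⋃ n, B n) x⟫_ℂ).re :=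
        Complex.hasSum_re ((innerSL ℂ x).hasSum h)
      change ENNReal.ofReal (⟪x, E.proj (⋃ n, B n) x⟫_ℂ).re = _
      rw [← h2.tsum_eq, ENNReal.ofReal_tsum_of_nonneg (fun n => E.inner_nonneg (hB n) x)
        h2.summable])

end ProjectionValuedMeasure

section SpectralProjection

variable {K : Type*} [NormedAddCommGroup K] [InnerProductSpace ℂ K] [CompleteSpace K]

/-- `E` is the spectral measure of the operator `A`, i.e. `A = ∫ t dE(t)`: the domain of `A` is
`{x | ∫ t² d⟪x, E(t) x⟫ < ∞}`, and `⟪x, A x⟫ = ∫ t d⟪x, E(t) x⟫` on this domain. -/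
structure IsSpectralMeasure (A : K →ₗ.[ℂ] K) (E : ProjectionValuedMeasure K) : Prop where
  mem_domain_iff : ∀ x : K, x ∈ A.domain ↔ Integrable (fun t : ℝ => t ^ 2) (E.scalarMeasure x)
  inner_apply : ∀ x : A.domain,
    ⟪(x : K), A x⟫_ℂ = ((∫ t : ℝ, t ∂(E.scalarMeasure (x : K)) : ℝ) : ℂ)

open Classical in
/-- The spectral projection `1_B(A)` of a selfadjoint operator `A`, for a Borel set `B ⊆ ℝ`:
the value at `B` of the spectral measure of `A`. (Junk value `0` for operators without a
spectral measure.) -/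
def spectralProjection (A : K →ₗ.[ℂ] K) (B : Set ℝ) : K →L[ℂ] K :=
  if h : ∃ E : ProjectionValuedMeasure K, IsSpectralMeasure A E then h.choose.proj B else 0

end SpectralProjection

/-! ### Complexified Maxwell-type operators -/

section Maxwell

variable {H : Type*} [NormedAddCommGroup H] [InnerProductSpace ℂ H]

/-- The product `W_L D W_R` with domain `W_R⁻¹ (dom D)`. -/
def productOperator (WL : H ≃L[ℂ] H) (D : H →ₗ.[ℂ] H) (WR : H ≃L[ℂ] H) : H →ₗ.[ℂ] H where
  domain := D.domain.comap (WR : H →ₗ[ℂ] H)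
  toFun := (WL : H →ₗ[ℂ] H) ∘ₗ D.toFun ∘ₗ
    ((WR : H →ₗ[ℂ] H).restrict (p := D.domain.comap (WR : H →ₗ[ℂ] H)) (q := D.domain)
      (fun _ hx => hx))

theorem productOperator_apply (WL : H ≃L[ℂ] H) (D : H →ₗ.[ℂ] H) (WR : H ≃L[ℂ] H)
    (x : (productOperator WL D WR).domain) :
    productOperator WL D WR x = WL (D ⟨WR (x : H), x.2⟩) := rfl

/-- A complexified Maxwell-type operator `W_L D W_R` on the complex Hilbert space `H`, together
with its complex conjugation `C`. -/
structure MaxwellTypeOperator (H : Type*) [NormedAddCommGroup H] [InnerProductSpace ℂ H]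
    [CompleteSpace H] where
  /-- the (possibly unbounded) selfadjoint operator `D` -/
  D : H →ₗ.[ℂ] H
  isSelfAdjoint_D : IsSelfAdjoint D
  /-- the left weight, a bounded operator with bounded inverse -/
  WL : H ≃L[ℂ] H
  /-- the right weight, a bounded operator with bounded inverse -/
  WR : H ≃L[ℂ] H
  isSelfAdjoint_WL : IsSelfAdjoint (WL : H →L[ℂ] H)
  isSelfAdjoint_WR : IsSelfAdjoint (WR : H →L[ℂ] H)
  commute : ∀ x, WL (WR x) = WR (WL x)
  /-- `W_R W_L⁻¹` is selfadjoint -/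
  isSelfAdjoint_weight : IsSelfAdjoint ((WR : H →L[ℂ] H) ∘L (WL.symm : H →L[ℂ] H))
  /-- `W_R W_L⁻¹ ≥ c > 0` -/
  bounded_below : ∃ c : ℝ, 0 < c ∧ ∀ x : H, c * ‖x‖ ^ 2 ≤ (⟪x, WR (WL.symm x)⟫_ℂ).re
  /-- the complex conjugation, an antiunitary (antilinear, isometric, bijective) map -/
  C : H ≃ₛₗᵢ[starRingEnd ℂ] H
  /-- `C` is even: `C² = 1` -/
  C_C : ∀ x, C (C x) = x
  /-- `C` maps the domain of `W_L D W_R` onto itself -/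
  C_image_domain : C '' ((productOperator WL D WR).domain : Set H) =
    ((productOperator WL D WR).domain : Set H)
  /-- `C (W_L D W_R) C x = - (W_L D W_R) x` for all `x` in the domain; here `y = C x` -/
  C_anticommute : ∀ x y : (productOperator WL D WR).domain, (y : H) = C (x : H) →
    C (productOperator WL D WR y) = - productOperator WL D WR x

namespace MaxwellTypeOperator

variable [CompleteSpace H]

theorem symm_WR (M : MaxwellTypeOperator H) (x : H) :
    M.WL.symm (M.WR x) = M.WR (M.WL.symm x) := by
  apply M.WL.injective
  rw [M.commute]
  simp

/-- The Hilbert space `H_W`: the vector space `H` with the weighted scalar product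
`⟪Φ, Ψ⟫_W = ⟪Φ, W_L⁻¹ W_R Ψ⟫`. -/
def WeightedSpace (_M : MaxwellTypeOperator H) : Type _ := H

instance (M : MaxwellTypeOperator H) : AddCommGroup M.WeightedSpace :=
  inferInstanceAs (AddCommGroup H)

instance (M : MaxwellTypeOperator H) : Module ℂ M.WeightedSpace :=
  inferInstanceAs (Module ℂ H)

/-- The identity map from `H_W` to `H`. -/
def toH (M : MaxwellTypeOperator H) : M.WeightedSpace ≃ₗ[ℂ] H := LinearEquiv.refl ℂ H

/-- The weighted scalar product. -/
@[reducible]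
def weightedCore (M : MaxwellTypeOperator H) : InnerProductSpace.Core ℂ M.WeightedSpace where
  inner x y := ⟪M.toH x, M.WL.symm (M.WR (M.toH y))⟫_ℂ
  conj_inner_symm x y := by
    have h := M.isSelfAdjoint_weight.isSymmetric (M.toH x) (M.toH y)
    have h' : ⟪M.WR (M.WL.symm (M.toH x)), M.toH y⟫_ℂ
      = ⟪M.toH x, M.WR (M.WL.symm (M.toH y))⟫_ℂ := h
    rw [inner_conj_symm, M.symm_WR, M.symm_WR, h']
  re_inner_nonneg x := by
    obtain ⟨c, hc, h⟩ := M.bounded_below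
    rw [M.symm_WR]
    exact le_trans (by positivity) (h (M.toH x))
  add_left x y z := by rw [map_add, inner_add_left]
  smul_left x y r := by rw [map_smul, inner_smul_left]
  definite x hx := by
    obtain ⟨c, hc, h⟩ := M.bounded_below
    have h1 := h (M.toH x)
    rw [← M.symm_WR, hx, Complex.zero_re] at h1
    have h2 : ‖M.toH x‖ ^ 2 ≤ 0 := by
      by_contra hn
      push Not at hn
      exact absurd h1 (not_le.mpr (mul_pos hc hn))
    have h3 : ‖M.toH x‖ = 0 := by
      have := le_antisymm h2 (sq_nonneg _)
      exact pow_eq_zero_iff (two_ne_zero) |>.mp this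
    exact M.toH.map_eq_zero_iff.mp (norm_eq_zero.mp h3)

instance (M : MaxwellTypeOperator H) : NormedAddCommGroup M.WeightedSpace :=
  @InnerProductSpace.Core.toNormedAddCommGroup ℂ M.WeightedSpace _ _ _ M.weightedCore

instance (M : MaxwellTypeOperator H) : InnerProductSpace ℂ M.WeightedSpace :=
  InnerProductSpace.ofCore M.weightedCore.toCore

theorem weighted_inner (M : MaxwellTypeOperator H) (x y : M.WeightedSpace) :
    ⟪x, y⟫_ℂ = ⟪M.toH x, M.WL.symm (M.WR (M.toH y))⟫_ℂ := rfl

instance (M : MaxwellTypeOperator H) : CompleteSpace M.WeightedSpace := by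
  obtain ⟨c, hc, h⟩ := M.bounded_below
  let S : H →L[ℂ] H := (M.WL.symm : H →L[ℂ] H) ∘L (M.WR : H →L[ℂ] H)
  have hsq : ∀ x : M.WeightedSpace, ‖x‖ ^ 2 = (⟪M.toH x, S (M.toH x)⟫_ℂ).re := fun x => by
    rw [← inner_self_eq_norm_sq (𝕜 := ℂ) x]; rfl
  have hlow : ∀ x : M.WeightedSpace, c * ‖M.toH x‖ ^ 2 ≤ ‖x‖ ^ 2 := fun x => by
    rw [hsq]
    have h1 := h (M.toH x)
    rw [← M.symm_WR] at h1
    exact h1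
  have hup : ∀ x : M.WeightedSpace, ‖x‖ ^ 2 ≤ ‖S‖ * ‖M.toH x‖ ^ 2 := fun x => by
    rw [hsq]
    calc (⟪M.toH x, S (M.toH x)⟫_ℂ).re ≤ ‖⟪M.toH x, S (M.toH x)⟫_ℂ‖ := Complex.re_le_norm _
      _ ≤ ‖M.toH x‖ * ‖S (M.toH x)‖ := norm_inner_le_norm _ _
      _ ≤ ‖M.toH x‖ * (‖S‖ * ‖M.toH x‖) := by gcongr; exact S.le_opNorm _
      _ = _ := by ring
  let e : M.WeightedSpace ≃L[ℂ] H := M.toH.toContinuousLinearEquivOfBounds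
    (Real.sqrt c⁻¹) (Real.sqrt ‖S‖)
    (fun x => by
      refine abs_le_of_sq_le_sq' ?_ (by positivity) |>.2
      rw [mul_pow, Real.sq_sqrt (by positivity), inv_mul_eq_div, le_div_iff₀ hc]
      linarith [hlow x])
    (fun y => by
      refine abs_le_of_sq_le_sq' ?_ (by positivity) |>.2
      rw [mul_pow, Real.sq_sqrt (by positivity)]
      simpa using hup (M.toH.symm y))
  exact (completeSpace_congr (e := e.toEquiv) e.isUniformEmbedding).mpr inferInstance

/-- The Maxwell-type operator `M^ℂ = W_L D W_R`, regarded as an operator on `H_W`. -/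
def op (M : MaxwellTypeOperator H) : M.WeightedSpace →ₗ.[ℂ] M.WeightedSpace where
  domain := (productOperator M.WL M.D M.WR).domain.comap (M.toH : M.WeightedSpace →ₗ[ℂ] H)
  toFun := (M.toH.symm : H →ₗ[ℂ] M.WeightedSpace) ∘ₗ (productOperator M.WL M.D M.WR).toFun ∘ₗ
    ((M.toH : M.WeightedSpace →ₗ[ℂ] H).restrict
      (p := (productOperator M.WL M.D M.WR).domain.comap (M.toH : M.WeightedSpace →ₗ[ℂ] H))
      (q := (productOperator M.WL M.D M.WR).domain) (fun _ hx => hx))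

/-- Complex conjugation on `H_W`. -/
def conj (M : MaxwellTypeOperator H) (x : M.WeightedSpace) : M.WeightedSpace :=
  M.toH.symm (M.C (M.toH x))

/-- The real part operator `Re = ½ (1 + C)` on `H_W`. -/
def re (M : MaxwellTypeOperator H) (x : M.WeightedSpace) : M.WeightedSpace :=
  (1 / 2 : ℂ) • (x + M.conj x)

/-- `Q₊ = 1_{(0,∞)}(M^ℂ) + ½ 1_{{0}}(M^ℂ)`. -/
def Qplus (M : MaxwellTypeOperator H) : M.WeightedSpace →L[ℂ] M.WeightedSpace :=
  spectralProjection M.op (Set.Ioi 0) + (1 / 2 : ℂ) • spectralProjection M.op {0}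

/-- `Q₋ = 1_{(0,∞)}(-M^ℂ) + ½ 1_{{0}}(M^ℂ)`. -/
def Qminus (M : MaxwellTypeOperator H) : M.WeightedSpace →L[ℂ] M.WeightedSpace :=
  spectralProjection (-M.op) (Set.Ioi 0) + (1 / 2 : ℂ) • spectralProjection M.op {0}

/-- The real waves `u = Re u` in `H_W`. -/
def realWaves (M : MaxwellTypeOperator H) : Set M.WeightedSpace := {u | M.re u = u}

end MaxwellTypeOperator

end Maxwell

end

/-!
If `u` is real, then `2 Re Q₊ u = Q₊ u + C Q₊ u`, so everything follows from two facts: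
`Q₊ + Q₋ = 1`, and `C Q₊ = Q₋ C`. Both would be immediate from `C M C = -M` if `C` were antiunitary
on `H_W`. It is antiunitary on `H` only, so that the conjugate by `C` of an orthogonal projection of
`H_W` is a priori an oblique one.

The tool that replaces unitarity is `IsSpectralMeasure.proj_intertwine`: a bounded real-linear map
`J` with `A' J ⊇ J A` intertwines the projections of `A` and `A'` for `(0, ∞)` and `{0}`. The reason
is that spectral subspaces can be recognized by growth rates, which are insensitive to a change to
an equivalent norm. On the range of `E([l - r, l + r])` the powers of `A - l` grow at most like `rⁿ`
(`norm_apply_sub_le`); on the range of `E'((-∞, 0])` those of `A' - l` grow at least like `lⁿ`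
(`mul_norm_le_norm_apply_sub`); for `r < l` this forces the component of `J x` in the latter to
vanish when `x` is in the former. With `J = 1` the same theorem gives the uniqueness needed to
identify `1_{(0,∞)}(-M)` with `1_{(-∞,0)}(M)`.

The spectral projections in the statement are those of some spectral measure, provided that one
exists, so the spectral theorem has to be proved as well (`IsSelfAdjoint.exists_isSpectralMeasure`).
For a representation `Φ` of `C(X)`, `X` compact metric, the Riesz-Markov-Kakutani theorem gives
measures `μ_x` with `⟪x, Φ(f) x⟫ = ∫ f dμ_x`. The map `f ↦ Φ(f) x` is isometric for the norm of
`L²(μ_x)`, so it extends to `L²(μ_x)`; indicator functions give the projections. This is applied to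
the continuous functional calculus of the bounded normal operator `(A + i)⁻¹`, and the result is
transported to `ℝ` by `z ↦ Re z⁻¹`. Finally `M` is selfadjoint on `H_W`
(`MaxwellTypeOperator.isSelfAdjoint_op`), because the weights cancel in
`⟪v, M x⟫_W = ⟪W_R v, D W_R x⟫`.
-/

/-! ### Selfadjoint unbounded operators -/

noncomputable section

section Unbounded

variable {K : Type*} [NormedAddCommGroup K] [InnerProductSpace ℂ K] [CompleteSpace K]
  {A : K →ₗ.[ℂ] K}

theorem IsSelfAdjoint.inner_pmap_left (hA : IsSelfAdjoint A) (x y : A.domain) :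
    ⟪A x, (y : K)⟫_ℂ = ⟪(x : K), A y⟫_ℂ := by
  have h := LinearPMap.adjoint_isFormalAdjoint hA.dense_domain
  rw [LinearPMap.isSelfAdjoint_def.mp hA] at h
  exact h x y

/-- A selfadjoint operator has no proper symmetric extension. -/
theorem IsSelfAdjoint.exists_pmap_eq (hA : IsSelfAdjoint A) {v w : K}
    (h : ∀ x : A.domain, ⟪w, (x : K)⟫_ℂ = ⟪v, A x⟫_ℂ) :
    ∃ hv : v ∈ A.domain, A ⟨v, hv⟩ = w := by
  have h1 := LinearPMap.mem_adjoint_domain_of_exists v ⟨w, h⟩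
  have h2 := LinearPMap.adjoint_apply_eq hA.dense_domain ⟨v, h1⟩ h
  have h3 := LinearPMap.isSelfAdjoint_def.mp hA
  have h4 : v ∈ A.domain := h3 ▸ h1
  exact ⟨h4, ((LinearPMap.ext_iff.mp h3).2 (hf := h1) (hg := h4)).symm.trans h2⟩

/-- A densely defined symmetric operator whose adjoint it extends is selfadjoint. -/
theorem LinearPMap.isSelfAdjoint_of_forall (hd : Dense (A.domain : Set K))
    (hs : ∀ x y : A.domain, ⟪A x, (y : K)⟫_ℂ = ⟪(x : K), A y⟫_ℂ)
    (hm : ∀ v w : K, (∀ x : A.domain, ⟪w, (x : K)⟫_ℂ = ⟪v, A x⟫_ℂ) → v ∈ A.domain) :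
    IsSelfAdjoint A := by
  rw [LinearPMap.isSelfAdjoint_def]
  have hle : A ≤ A.adjoint := LinearPMap.IsFormalAdjoint.le_adjoint hd hs
  refine (LinearPMap.eq_of_le_of_domain_eq hle ?_).symm
  refine le_antisymm hle.1 fun v hv => hm v (A.adjoint ⟨v, hv⟩) fun x => ?_
  exact LinearPMap.adjoint_isFormalAdjoint hd ⟨v, hv⟩ x

theorem IsSelfAdjoint.neg_pmap (hA : IsSelfAdjoint A) : IsSelfAdjoint (-A) := by
  refine LinearPMap.isSelfAdjoint_of_forall hA.dense_domain (fun x y => ?_) fun v w h => ?_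
  · rw [LinearPMap.neg_apply, LinearPMap.neg_apply, inner_neg_left, inner_neg_right]
    exact congrArg _ (hA.inner_pmap_left x y)
  · refine (hA.exists_pmap_eq (v := v) (w := -w) fun x => ?_).1
    have := h x
    rw [LinearPMap.neg_apply, inner_neg_right] at this
    rw [inner_neg_left, this, neg_neg]

theorem IsSelfAdjoint.inner_pmap_self_im (hA : IsSelfAdjoint A) (x : A.domain) :
    (⟪(x : K), A x⟫_ℂ).im = 0 := by
  rw [← Complex.conj_eq_iff_im, inner_conj_symm]
  exact hA.inner_pmap_left x x

theorem IsSelfAdjoint.norm_sq_pmap_add_I (hA : IsSelfAdjoint A) (x : A.domain) :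
    ‖A x + Complex.I • (x : K)‖ ^ 2 = ‖A x‖ ^ 2 + ‖(x : K)‖ ^ 2 := by
  rw [norm_add_sq (𝕜 := ℂ), inner_smul_right, norm_smul, hA.inner_pmap_left x x]
  simp [hA.inner_pmap_self_im x]

/-- The operator `A + i` is onto for selfadjoint `A`. -/
theorem IsSelfAdjoint.exists_pmap_add_I_eq (hA : IsSelfAdjoint A) (y : K) :
    ∃ x : A.domain, A x + Complex.I • (x : K) = y := by
  let T : A.domain →ₗ[ℂ] K := A.toFun + Complex.I • A.domain.subtype
  have hT : ∀ x, T x = A x + Complex.I • (x : K) := fun x => rfl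
  -- `A + i` is bounded below and `A` is closed, so the range is closed.
  have hcl : IsClosed (LinearMap.range T : Set K) := by
    refine isClosed_of_closure_subset fun z hz => ?_
    obtain ⟨s, hs, hsz⟩ := mem_closure_iff_seq_limit.mp hz
    choose u hu using hs
    have hle : ∀ m n, dist (u m : K) (u n) ≤ dist (s m) (s n) := fun m n => by
      rw [dist_eq_norm, dist_eq_norm, ← hu, ← hu, ← map_sub, hT]
      have h := hA.norm_sq_pmap_add_I (u m - u n)
      refine le_of_sq_le_sq ?_ (norm_nonneg _)
      rw [h]
      simp
    have hcs : CauchySeq fun n => (u n : K) := by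
      have h := Metric.cauchySeq_iff.mp hsz.cauchySeq
      refine Metric.cauchySeq_iff.mpr fun ε hε => ?_
      obtain ⟨N, hN⟩ := h ε hε
      exact ⟨N, fun m hm n hn => (hle m n).trans_lt (hN m hm n hn)⟩
    obtain ⟨x, hx⟩ := cauchySeq_tendsto_of_complete hcs
    have hAu : Filter.Tendsto (fun n => A (u n)) Filter.atTop (nhds (z - Complex.I • x)) := by
      refine (hsz.sub (hx.const_smul Complex.I)).congr fun n => ?_
      rw [← hu, hT]; simp
    obtain ⟨hxd, hAx⟩ := hA.exists_pmap_eq (v := x) (w := z - Complex.I • x) fun w =>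
      tendsto_nhds_unique (hAu.inner tendsto_const_nhds)
        ((hx.inner tendsto_const_nhds).congr fun n => (hA.inner_pmap_left (u n) w).symm)
    exact ⟨⟨x, hxd⟩, by rw [hT, hAx]; simp⟩
  -- A vector orthogonal to the range is an eigenvector of `A` for the eigenvalue `i`.
  have horth : (LinearMap.range T)ᗮ = ⊥ := by
    refine (Submodule.eq_bot_iff _).mpr fun v hv => ?_
    have hv' : ∀ x : A.domain, ⟪Complex.I • v, (x : K)⟫_ℂ = ⟪v, A x⟫_ℂ := fun x => by
      have h := (Submodule.mem_orthogonal' _ _).mp hv (T x) ⟨x, rfl⟩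
      rw [hT, inner_add_right, inner_smul_right] at h
      rw [inner_smul_left, Complex.conj_I]
      linear_combination -h
    obtain ⟨hvd, hAv⟩ := hA.exists_pmap_eq hv'
    have h := hA.inner_pmap_self_im ⟨v, hvd⟩
    rw [hAv, inner_smul_right, inner_self_eq_norm_sq_to_K] at h
    have h' : ‖v‖ ^ 2 = 0 := by
      have h2 : (Complex.I * ((‖v‖ ^ 2 : ℝ) : ℂ)).im = 0 := by simpa using h
      rwa [Complex.I_mul_im, Complex.ofReal_re] at h2
    simpa using h'
  have := hcl.completeSpace_coe
  have htop : LinearMap.range T = ⊤ := Submodule.orthogonal_eq_bot_iff.mp horth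
  exact LinearMap.range_eq_top.mp htop y

theorem IsSelfAdjoint.exists_pmap_sub_I_eq (hA : IsSelfAdjoint A) (y : K) :
    ∃ x : A.domain, A x - Complex.I • (x : K) = y := by
  obtain ⟨x, hx⟩ := hA.neg_pmap.exists_pmap_add_I_eq (-y)
  refine ⟨x, ?_⟩
  rw [LinearPMap.neg_apply] at hx
  rw [← neg_inj, ← hx]
  abel

end Unbounded
end

/-! ### Projection-valued measures -/

noncomputable section

namespace ProjectionValuedMeasure

variable {K : Type*} [NormedAddCommGroup K] [InnerProductSpace ℂ K] [CompleteSpace K]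
  (E : ProjectionValuedMeasure K) {B B' : Set ℝ}

theorem proj_proj (hB : MeasurableSet B) (x : K) : E.proj B (E.proj B x) = E.proj B x :=
  congrArg (fun T : K →L[ℂ] K => T x) (E.isStarProjection B hB).1

theorem inner_proj_left (hB : MeasurableSet B) (x y : K) :
    ⟪E.proj B x, y⟫_ℂ = ⟪x, E.proj B y⟫_ℂ :=
  (E.isStarProjection B hB).2.isSymmetric x y

theorem inner_proj_self (hB : MeasurableSet B) (x : K) :
    ⟪x, E.proj B x⟫_ℂ = ((‖E.proj B x‖ ^ 2 : ℝ) : ℂ) := by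
  rw [← E.proj_proj hB, ← E.inner_proj_left hB, E.proj_proj hB, inner_self_eq_norm_sq_to_K]
  simp

theorem scalarMeasure_apply (hB : MeasurableSet B) (x : K) :
    E.scalarMeasure x B = ENNReal.ofReal (‖E.proj B x‖ ^ 2) := by
  rw [scalarMeasure, Measure.ofMeasurable_apply _ hB, E.inner_proj_self hB, Complex.ofReal_re]

theorem proj_univ_apply (x : K) : E.proj Set.univ x = x := by
  rw [E.proj_univ]; rfl

instance (x : K) : IsFiniteMeasure (E.scalarMeasure x) :=
  ⟨by rw [E.scalarMeasure_apply MeasurableSet.univ]; exact ENNReal.ofReal_lt_top⟩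

theorem scalarMeasure_real_univ (x : K) : (E.scalarMeasure x).real Set.univ = ‖x‖ ^ 2 := by
  rw [Measure.real, E.scalarMeasure_apply MeasurableSet.univ, proj_univ_apply,
    ENNReal.toReal_ofReal (by positivity)]

theorem proj_union (hB : MeasurableSet B) (hB' : MeasurableSet B') (hd : Disjoint B B') (x : K) :
    E.proj (B ∪ B') x = E.proj B x + E.proj B' x := by
  let S : ℕ → Set ℝ := fun n => if n = 0 then B else if n = 1 then B' else ∅
  have hS : ⋃ n, S n = B ∪ B' := by
    ext t
    simp only [Set.mem_iUnion, Set.mem_union, S]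
    constructor
    · rintro ⟨n, hn⟩
      split_ifs at hn
      exacts [Or.inl hn, Or.inr hn, hn.elim]
    · rintro (h | h)
      exacts [⟨0, by simpa using h⟩, ⟨1, by simpa using h⟩]
  have h := E.hasSum_iUnion S (fun n => by
      simp only [S]; split_ifs
      exacts [hB, hB', MeasurableSet.empty]) (fun i j hij => by
      simp only [Function.onFun, S]
      split_ifs with h1 h2 h3 h4 h5
      all_goals first
        | exact hd | exact hd.symm | exact Set.disjoint_empty _ | exact Set.empty_disjoint _
        | exact absurd (by omega) hij) x
  rw [hS] at h
  refine h.unique ?_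
  have h2 := hasSum_sum_of_ne_finset_zero (L := .unconditional ℕ) (f := fun n => E.proj (S n) x) (s := {0, 1})
    (fun n hn => by
      have : S n = ∅ := by
        simp only [Finset.mem_insert, Finset.mem_singleton, not_or] at hn
        simp [S, hn]
      rw [this, proj_empty])
  simpa [S] using h2

theorem proj_add_compl (hB : MeasurableSet B) (x : K) : E.proj B x + E.proj Bᶜ x = x := by
  rw [← E.proj_union hB hB.compl disjoint_compl_right, Set.union_compl_self, proj_univ_apply]

theorem proj_proj_of_disjoint (hB : MeasurableSet B) (hB' : MeasurableSet B') (hd : Disjoint B B')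
    (x : K) : E.proj B (E.proj B' x) = 0 := by
  -- With `y = E(B')x`, idempotence of `E(B) + E(B')` gives `E(B)y + E(B')E(B)y = 0`.
  have h : E.proj B (E.proj B' x) + E.proj B' (E.proj B (E.proj B' x)) = 0 := by
    have h1 := E.proj_proj (hB.union hB') (E.proj B' x)
    simp only [E.proj_union hB hB' hd, map_add, E.proj_proj hB, E.proj_proj hB'] at h1
    rw [← sub_eq_zero.mpr h1]
    abel
  have h2 := congrArg (fun v => ⟪E.proj B' x, v⟫_ℂ) h
  simp only [inner_add_right, inner_zero_right] at h2
  rw [← E.inner_proj_left hB', E.proj_proj hB', E.inner_proj_self hB, ← Complex.ofReal_add,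
    Complex.ofReal_eq_zero] at h2
  have h3 : ‖E.proj B (E.proj B' x)‖ ^ 2 = 0 := by linarith
  simpa using h3

theorem proj_proj_inter (hB : MeasurableSet B) (hB' : MeasurableSet B') (x : K) :
    E.proj B (E.proj B' x) = E.proj (B ∩ B') x := by
  have h1 (y : K) : E.proj B y = E.proj (B ∩ B') y + E.proj (B \ B') y := by
    rw [← E.proj_union (hB.inter hB') (hB.diff hB') Set.disjoint_sdiff_inter.symm,
      Set.inter_union_sdiff]
  have h2 : E.proj B' x = E.proj (B ∩ B') x + E.proj (B' \ B) x := by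
    rw [← E.proj_union (hB.inter hB') (hB'.diff hB), Set.inter_comm, Set.inter_union_sdiff]
    exact Set.disjoint_left.mpr fun t h h' => h'.2 h.1
  rw [h1, E.proj_proj_of_disjoint (hB.diff hB') hB' Set.disjoint_sdiff_left, add_zero, h2, map_add,
    E.proj_proj (hB.inter hB'), E.proj_proj_of_disjoint (hB.inter hB') (hB'.diff hB), add_zero]
  exact Set.disjoint_left.mpr fun t h h' => h'.2 h.1

theorem scalarMeasure_proj (hB : MeasurableSet B) (x : K) :
    E.scalarMeasure (E.proj B x) = (E.scalarMeasure x).restrict B := by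
  ext S hS
  rw [Measure.restrict_apply hS, E.scalarMeasure_apply hS, E.scalarMeasure_apply (hS.inter hB),
    E.proj_proj_inter hS hB]

theorem tendsto_proj_iUnion {B : ℕ → Set ℝ} (hB : ∀ n, MeasurableSet (B n)) (hm : Monotone B)
    (x : K) :
    Filter.Tendsto (fun n => E.proj (B n) x) Filter.atTop (nhds (E.proj (⋃ n, B n) x)) := by
  have hU := MeasurableSet.iUnion hB
  have hsub (n) : E.proj (⋃ n, B n) x - E.proj (B n) x = E.proj ((⋃ n, B n) \ B n) x := by
    rw [sub_eq_iff_eq_add', ← E.proj_union (hB n) (hU.diff (hB n)) Set.disjoint_sdiff_right,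
      Set.union_sdiff_cancel (Set.subset_iUnion B n)]
  have h0 : Filter.Tendsto (fun n => E.scalarMeasure x ((⋃ n, B n) \ B n)) Filter.atTop
      (nhds 0) := by
    have := tendsto_measure_iInter_atTop (μ := E.scalarMeasure x)
      (s := fun n => (⋃ n, B n) \ B n) (fun n => (hU.diff (hB n)).nullMeasurableSet)
      (fun i j hij => Set.sdiff_subset_sdiff_right (hm hij)) ⟨0, measure_ne_top _ _⟩
    rwa [← Set.sdiff_iUnion, Set.sdiff_self, measure_empty] at this
  have h1 := (ENNReal.tendsto_toReal ENNReal.zero_ne_top).comp h0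
  rw [tendsto_iff_norm_sub_tendsto_zero]
  have h2 := h1.sqrt
  simp only [ENNReal.toReal_zero, Real.sqrt_zero] at h2
  refine h2.congr fun n => ?_
  rw [Function.comp_apply, E.scalarMeasure_apply (hU.diff (hB n)), ← hsub,
    ENNReal.toReal_ofReal (by positivity), Real.sqrt_sq (norm_nonneg _), norm_sub_rev]

/-- The compact intervals exhausting the positive half-line recover its projection. -/
theorem tendsto_proj_Icc (x : K) :
    Filter.Tendsto (fun n : ℕ => E.proj (Set.Icc (1 / ((n : ℝ) + 1)) (n + 1)) x) Filter.atTop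
      (nhds (E.proj (Set.Ioi 0) x)) := by
  have hU : ⋃ n : ℕ, Set.Icc (1 / ((n : ℝ) + 1)) (n + 1) = Set.Ioi 0 := by
    ext t
    simp only [Set.mem_iUnion, Set.mem_Icc, Set.mem_Ioi]
    constructor
    · rintro ⟨n, h, -⟩
      exact lt_of_lt_of_le (by positivity) h
    · intro ht
      obtain ⟨m, hm⟩ := exists_nat_ge (max t t⁻¹)
      have h1 := (le_max_left _ _).trans hm
      have h2 := (le_max_right _ _).trans hm
      refine ⟨m, ?_, by linarith⟩
      rw [one_div]
      exact inv_le_of_inv_le₀ ht (by linarith)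
  rw [← hU]
  refine E.tendsto_proj_iUnion (fun n => measurableSet_Icc) (fun m n hmn => ?_) x
  have : (m : ℝ) ≤ n := by exact_mod_cast hmn
  refine Set.Icc_subset_Icc ?_ (by linarith)
  gcongr

theorem proj_Ioi_add_proj_singleton_add_proj_Iio (x : K) :
    E.proj (Set.Ioi 0) x + E.proj {0} x + E.proj (Set.Iio 0) x = x := by
  rw [← E.proj_union measurableSet_Ioi (measurableSet_singleton 0) (by simp),
    ← E.proj_union (measurableSet_Ioi.union (measurableSet_singleton 0)) measurableSet_Iio]
  · convert E.proj_univ_apply x using 2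
    congr 1
    ext t
    rcases lt_trichotomy t 0 with ht | ht | ht <;> simp [ht]
  · refine Set.disjoint_left.mpr fun t ht ht' => ?_
    simp only [Set.mem_union, Set.mem_Ioi, Set.mem_singleton_iff, Set.mem_Iio] at ht ht'
    rcases ht with ht | ht <;> linarith

theorem proj_eq_zero_of_subset {C : Set ℝ} (hB : MeasurableSet B)
    (hC : MeasurableSet C) (hBC : B ⊆ C) {x : K} (hx : E.proj C x = 0) : E.proj B x = 0 := by
  rw [← Set.inter_eq_left.mpr hBC, ← E.proj_proj_inter hB hC, hx, map_zero]

/-- The image of a projection-valued measure under the reflection `t ↦ -t`. -/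
def reflect : ProjectionValuedMeasure K where
  proj B := E.proj (-B)
  isStarProjection B hB := E.isStarProjection _ hB.neg
  proj_univ := by simpa using E.proj_univ
  hasSum_iUnion B hB hd x := by
    have h := E.hasSum_iUnion (fun n => -B n) (fun n => (hB n).neg)
      (fun i j hij => (hd hij).preimage _) x
    rwa [← Set.iUnion_neg] at h

theorem reflect_proj (B : Set ℝ) : E.reflect.proj B = E.proj (-B) := rfl

theorem scalarMeasure_reflect (x : K) :
    E.reflect.scalarMeasure x = (E.scalarMeasure x).map (fun t => -t) := by
  ext B hB
  rw [Measure.map_apply measurable_neg hB, scalarMeasure_apply _ hB,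
    scalarMeasure_apply _ (measurable_neg hB)]
  rfl

end ProjectionValuedMeasure
end

/-! ### Operators with a spectral measure -/

noncomputable section

namespace IsSpectralMeasure

variable {K : Type*} [NormedAddCommGroup K] [InnerProductSpace ℂ K] [CompleteSpace K]
  {A : K →ₗ.[ℂ] K} {E : ProjectionValuedMeasure K} {B : Set ℝ}

theorem reflect (h : IsSpectralMeasure A E) : IsSpectralMeasure (-A) E.reflect where
  mem_domain_iff x := by
    rw [E.scalarMeasure_reflect, integrable_map_measure (by fun_prop) (by fun_prop)]
    simpa [Function.comp_def] using h.mem_domain_iff x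
  inner_apply x := by
    rw [E.scalarMeasure_reflect, integral_map (by fun_prop) (by fun_prop), integral_neg,
      LinearPMap.neg_apply, inner_neg_right, h.inner_apply x]
    simp

theorem integrable_id (h : IsSpectralMeasure A E) (x : A.domain) :
    Integrable (fun t : ℝ => t) (E.scalarMeasure (x : K)) :=
  ((memLp_two_iff_integrable_sq (by fun_prop)).mpr ((h.mem_domain_iff x).mp x.2)).integrable
    one_le_two

theorem proj_mem_domain (h : IsSpectralMeasure A E) (hB : MeasurableSet B) {x : K}
    (hx : x ∈ A.domain) : E.proj B x ∈ A.domain := by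
  rw [h.mem_domain_iff, E.scalarMeasure_proj hB]
  exact ((h.mem_domain_iff x).mp hx).restrict

theorem mem_domain_of_subset_Icc (h : IsSpectralMeasure A E) (hB : MeasurableSet B) {a b : ℝ}
    (hsub : B ⊆ Set.Icc a b) {x : K} (hx : E.proj B x = x) : x ∈ A.domain := by
  rw [h.mem_domain_iff, ← hx, E.scalarMeasure_proj hB]
  refine Integrable.of_bound (by fun_prop) (max |a| |b| ^ 2) ?_
  filter_upwards [ae_restrict_mem hB] with t ht
  rw [Real.norm_eq_abs, abs_pow]
  gcongr
  exact abs_le_max_abs_abs (hsub ht).1 (hsub ht).2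

/-- On the range of `E(B)` the form of `A` is bounded below by any lower bound of `B`. -/
theorem mul_norm_sq_le_inner (h : IsSpectralMeasure A E) (hB : MeasurableSet B) {c : ℝ}
    (hc : ∀ t ∈ B, c ≤ t) (x : A.domain) (hx : E.proj B x = x) :
    c * ‖(x : K)‖ ^ 2 ≤ (⟪(x : K), A x⟫_ℂ).re := by
  rw [h.inner_apply, Complex.ofReal_re]
  have h1 : ∫ _t : ℝ, c ∂(E.scalarMeasure (x : K)) = c * ‖(x : K)‖ ^ 2 := by
    rw [integral_const, E.scalarMeasure_real_univ, smul_eq_mul, mul_comm]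
  rw [← h1]
  refine integral_mono_ae (integrable_const c) (h.integrable_id x) ?_
  rw [← hx, E.scalarMeasure_proj hB]
  filter_upwards [ae_restrict_mem hB] with t ht using hc t ht

theorem inner_le_mul_norm_sq (h : IsSpectralMeasure A E) (hB : MeasurableSet B) {c : ℝ}
    (hc : ∀ t ∈ B, t ≤ c) (x : A.domain) (hx : E.proj B x = x) :
    (⟪(x : K), A x⟫_ℂ).re ≤ c * ‖(x : K)‖ ^ 2 := by
  have h1 := h.reflect.mul_norm_sq_le_inner (B := -B) (c := -c) hB.neg
    (fun t ht => by have := hc (-t) ht; linarith) x (by simpa [E.reflect_proj] using hx)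
  rw [LinearPMap.neg_apply, inner_neg_right, Complex.neg_re] at h1
  linarith

/-- The form of `A` has no off-diagonal part with respect to `E(B)` and `E(Bᶜ)`. -/
theorem inner_proj_compl (h : IsSpectralMeasure A E) (hB : MeasurableSet B) {y z : A.domain}
    (hy : E.proj B y = y) (hz : E.proj Bᶜ z = z) : ⟪(y : K), A z⟫_ℂ = 0 := by
  have key : ∀ y z : A.domain, E.proj B y = y → E.proj Bᶜ z = z →
      ⟪(y : K), A z⟫_ℂ + ⟪(z : K), A y⟫_ℂ = 0 := fun y z hy hz => by
    have hyz : E.proj B ((y + z : A.domain) : K) = y := by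
      rw [Submodule.coe_add, map_add, hy, ← hz,
        E.proj_proj_of_disjoint hB hB.compl disjoint_compl_right, add_zero]
    have hyz' : E.proj Bᶜ ((y + z : A.domain) : K) = z := by
      rw [Submodule.coe_add, map_add, hz, ← hy,
        E.proj_proj_of_disjoint hB.compl hB disjoint_compl_left, zero_add]
    have h1 := h.inner_apply (y + z)
    rw [← integral_add_compl hB (h.integrable_id (y + z)), ← E.scalarMeasure_proj hB,
      ← E.scalarMeasure_proj hB.compl, hyz, hyz', Complex.ofReal_add, ← h.inner_apply,
      ← h.inner_apply, LinearPMap.map_add, Submodule.coe_add, inner_add_left, inner_add_right,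
      inner_add_right] at h1
    linear_combination h1
  -- comparing `z` with `i z` separates the two terms
  have h1 := key y z hy hz
  have h2 := key y (Complex.I • z) hy (by rw [Submodule.coe_smul, map_smul, hz])
  rw [LinearPMap.map_smul, inner_smul_right, Submodule.coe_smul, inner_smul_left,
    Complex.conj_I] at h2
  linear_combination (1 / 2) * h1 - (Complex.I / 2) * h2 +
    (1 / 2) * (⟪(y : K), A z⟫_ℂ - ⟪(z : K), A y⟫_ℂ) * Complex.I_sq

/-- A selfadjoint operator maps the range of `E(Bᶜ)` into itself. -/
theorem proj_apply_proj_compl (h : IsSpectralMeasure A E) (hd : Dense (A.domain : Set K))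
    (hB : MeasurableSet B) {z : A.domain} (hz : E.proj Bᶜ z = z) : E.proj B (A z) = 0 := by
  refine hd.eq_zero_of_inner_right ℂ fun u hu => ?_
  rw [← E.inner_proj_left hB]
  exact h.inner_proj_compl hB (y := ⟨_, h.proj_mem_domain hB hu⟩) (E.proj_proj hB u) hz

/-- A selfadjoint operator commutes with its spectral projections. -/
theorem apply_proj (h : IsSpectralMeasure A E) (hd : Dense (A.domain : Set K))
    (hB : MeasurableSet B) (x : A.domain) :
    A ⟨E.proj B x, h.proj_mem_domain hB x.2⟩ = E.proj B (A x) := by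
  set y : A.domain := ⟨E.proj B x, h.proj_mem_domain hB x.2⟩
  set z : A.domain := ⟨E.proj Bᶜ x, h.proj_mem_domain hB.compl x.2⟩
  have hx : x = y + z := Subtype.ext (E.proj_add_compl hB x).symm
  have hz := h.proj_apply_proj_compl hd hB (z := z) (E.proj_proj hB.compl x)
  have hy := h.proj_apply_proj_compl hd hB.compl (z := y)
    (by rw [compl_compl]; exact E.proj_proj hB x)
  have h1 := E.proj_add_compl hB (A y)
  rw [hy, add_zero] at h1
  rw [hx, LinearPMap.map_add, map_add, hz, add_zero, h1]

/-- On the range of `E([l - r, l + r])` the operator `A - l` has norm at most `r`. -/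
theorem norm_apply_sub_le (h : IsSpectralMeasure A E) (hA : IsSelfAdjoint A) {l r : ℝ}
    (hr : 0 < r) (x : A.domain) (hx : E.proj (Set.Icc (l - r) (l + r)) x = x) :
    ‖A x - l • (x : K)‖ ≤ r * ‖(x : K)‖ := by
  have hB : MeasurableSet (Set.Icc (l - r) (l + r)) := measurableSet_Icc
  have hform : ∀ v : A.domain, E.proj (Set.Icc (l - r) (l + r)) v = v →
      |(⟪(v : K), A v - l • (v : K)⟫_ℂ).re| ≤ r * ‖(v : K)‖ ^ 2 := fun v hv => by
    have h1 := h.mul_norm_sq_le_inner hB (fun t ht => ht.1) v hv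
    have h2 := h.inner_le_mul_norm_sq hB (fun t ht => ht.2) v hv
    have h3 : (⟪(v : K), A v - l • (v : K)⟫_ℂ).re = (⟪(v : K), A v⟫_ℂ).re - l * ‖(v : K)‖ ^ 2 := by
      rw [inner_sub_right, inner_smul_right_eq_smul, inner_self_eq_norm_sq_to_K]
      simp [← Complex.ofReal_pow]
    rw [h3, abs_le]
    constructor <;> linarith
  -- Polarization of the form at `x ± r⁻¹ w`, where `w = (A - l) x`.
  set w : K := A x - l • (x : K) with hw
  have hwB : E.proj (Set.Icc (l - r) (l + r)) w = w := by
    have h1 : A x = E.proj (Set.Icc (l - r) (l + r)) (A x) := by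
      rw [← h.apply_proj hA.dense_domain hB x]
      exact congrArg A (Subtype.ext hx.symm)
    rw [hw, map_sub, ← h1, ← Complex.coe_smul, map_smul, hx]
  have hwd : w ∈ A.domain := h.mem_domain_of_subset_Icc hB subset_rfl hwB
  let y : A.domain := ((r⁻¹ : ℝ) : ℂ) • ⟨w, hwd⟩
  have hy : (y : K) = ((r⁻¹ : ℝ) : ℂ) • w := rfl
  have hyB : E.proj (Set.Icc (l - r) (l + r)) y = y := by rw [hy, map_smul, hwB]
  have h1 := (abs_le.mp (hform (x + y) (by rw [Submodule.coe_add, map_add, hx, hyB]))).2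
  have h2 := (abs_le.mp (hform (x - y) (by rw [Submodule.coe_sub, map_sub, hx, hyB]))).1
  have hpar := parallelogram_law_with_norm ℂ (x : K) (y : K)
  have hny : ‖(y : K)‖ = r⁻¹ * ‖w‖ := by
    rw [hy, norm_smul, Complex.norm_real, Real.norm_of_nonneg (by positivity)]
  have hcross : (⟪((x + y : A.domain) : K), A (x + y) - l • ((x + y : A.domain) : K)⟫_ℂ).re -
      (⟪((x - y : A.domain) : K), A (x - y) - l • ((x - y : A.domain) : K)⟫_ℂ).re =
      4 * (r⁻¹ * ‖w‖ ^ 2) := by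
    have e1 : A (x + y) - l • ((x + y : A.domain) : K) = w + (A y - l • (y : K)) := by
      rw [LinearPMap.map_add, Submodule.coe_add, smul_add, hw]; abel
    have e2 : A (x - y) - l • ((x - y : A.domain) : K) = w - (A y - l • (y : K)) := by
      rw [LinearPMap.map_sub, Submodule.coe_sub, smul_sub, hw]; abel
    have e3 : ⟪(x : K), A y - l • (y : K)⟫_ℂ = ⟪w, (y : K)⟫_ℂ := by
      rw [hw, inner_sub_left, inner_sub_right, hA.inner_pmap_left, inner_smul_left_eq_smul,
        inner_smul_right_eq_smul]
    have e4 : (⟪w, (y : K)⟫_ℂ).re = r⁻¹ * ‖w‖ ^ 2 := by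
      rw [hy, inner_smul_right, inner_self_eq_norm_sq_to_K]
      simp [← Complex.ofReal_pow]
    have e5 : (⟪(y : K), w⟫_ℂ).re = r⁻¹ * ‖w‖ ^ 2 := by
      rw [← e4, ← inner_conj_symm, Complex.conj_re]
    rw [e1, e2, Submodule.coe_add, Submodule.coe_sub]
    simp only [inner_add_left, inner_add_right, inner_sub_left, inner_sub_right, Complex.add_re,
      Complex.sub_re] at e3 ⊢
    have e3' := congrArg Complex.re e3
    simp only [Complex.sub_re] at e3'
    linarith
  rw [Submodule.coe_add] at h1 hcross
  rw [Submodule.coe_sub] at h2 hcross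
  refine le_of_sq_le_sq ?_ (by positivity)
  have h3 : 4 * (r⁻¹ * ‖w‖ ^ 2) ≤ r * (2 * (‖(x : K)‖ ^ 2 + (r⁻¹ * ‖w‖) ^ 2)) := by
    rw [← hny, ← hpar, ← hcross, mul_add]
    nlinarith
  have h4 : r * (r * (2 * (‖(x : K)‖ ^ 2 + (r⁻¹ * ‖w‖) ^ 2))) =
      2 * r ^ 2 * ‖(x : K)‖ ^ 2 + 2 * ‖w‖ ^ 2 := by field_simp
  have h5 := mul_le_mul_of_nonneg_left h3 hr.le
  rw [h4] at h5
  have h6 : r * (4 * (r⁻¹ * ‖w‖ ^ 2)) = 4 * ‖w‖ ^ 2 := by field_simp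
  rw [mul_pow]
  linarith

end IsSpectralMeasure
end

/-! ### Intertwining maps and spectral projections -/

noncomputable section

namespace IsSpectralMeasure

variable {K : Type*} [NormedAddCommGroup K] [InnerProductSpace ℂ K] [CompleteSpace K]
  {A A' : K →ₗ.[ℂ] K} {E E' : ProjectionValuedMeasure K} {B : Set ℝ} {J : K →L[ℝ] K}

theorem apply_proj_sub_smul (h : IsSpectralMeasure A E) (hd : Dense (A.domain : Set K))
    (hB : MeasurableSet B) (l : ℝ) (x : A.domain) :
    A ⟨E.proj B x, h.proj_mem_domain hB x.2⟩ - l • E.proj B x = E.proj B (A x - l • (x : K)) := by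
  rw [h.apply_proj hd hB, map_sub, ← Complex.coe_smul, ← Complex.coe_smul, map_smul]

/-- To the left of `l - r` the operator `A - l` is bounded below by `r`. -/
theorem mul_norm_le_norm_apply_sub (h : IsSpectralMeasure A E) (hB : MeasurableSet B) {l r : ℝ}
    (hc : ∀ t ∈ B, t ≤ l - r) (x : A.domain) (hx : E.proj B x = x) :
    r * ‖(x : K)‖ ≤ ‖A x - l • (x : K)‖ := by
  have h1 := h.inner_le_mul_norm_sq hB hc x hx
  have h2 : (⟪(x : K), A x - l • (x : K)⟫_ℂ).re = (⟪(x : K), A x⟫_ℂ).re - l * ‖(x : K)‖ ^ 2 := by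
    rw [inner_sub_right, inner_smul_right_eq_smul, inner_self_eq_norm_sq_to_K]
    simp [← Complex.ofReal_pow]
  have h3 := (abs_le.mp ((Complex.abs_re_le_norm _).trans
    (norm_inner_le_norm (𝕜 := ℂ) (x : K) (A x - l • (x : K))))).1
  rcases eq_or_lt_of_le (norm_nonneg (x : K)) with h0 | h0
  · rw [← h0, mul_zero]; exact norm_nonneg _
  · refine le_of_mul_le_mul_left ?_ h0
    nlinarith

/-- A bounded map intertwining `A` and `A'` carries spectral subspaces of `A` for compact
intervals in `(0, ∞)` into the spectral subspace of `A'` for `(0, ∞)`. The proof compares the growth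
of the powers of `A - l` on the first with that of the powers of `A' - l` on the complement of the
second, `l` being the centre of the interval. -/
theorem proj_Iic_intertwine_of_Icc (h : IsSpectralMeasure A E) (h' : IsSpectralMeasure A' E')
    (hA : IsSelfAdjoint A) (hA' : IsSelfAdjoint A')
    (hJ : ∀ x : A.domain, ∃ hx : J x ∈ A'.domain, A' ⟨J x, hx⟩ = J (A x))
    {a b : ℝ} (ha : 0 < a) (hab : a < b) {x : K} (hx : E.proj (Set.Icc a b) x = x) :
    E'.proj (Set.Iic 0) (J x) = 0 := by
  obtain ⟨l, r, hl, hr, hr0, hlr⟩ : ∃ l r : ℝ, a = l - r ∧ b = l + r ∧ 0 < r ∧ r < l :=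
    ⟨(a + b) / 2, (b - a) / 2, by ring, by ring, by linarith, by linarith⟩
  subst hl hr
  have hIic : MeasurableSet (Set.Iic (0 : ℝ)) := measurableSet_Iic
  have key : ∀ n : ℕ, ∀ x : K, E.proj (Set.Icc (l - r) (l + r)) x = x →
      l ^ n * ‖E'.proj (Set.Iic 0) (J x)‖ ≤ ‖E'.proj (Set.Iic 0)‖ * (‖J‖ * (r ^ n * ‖x‖)) := by
    intro n
    induction n with
    | zero =>
      intro x _
      simp only [pow_zero, one_mul]
      exact ((E'.proj _).le_opNorm _).trans (by gcongr; exact J.le_opNorm x)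
    | succ n ih =>
      intro x hx
      have hxd := h.mem_domain_of_subset_Icc measurableSet_Icc subset_rfl hx
      obtain ⟨hJd, hJx⟩ := hJ ⟨x, hxd⟩
      have hy : E.proj (Set.Icc (l - r) (l + r)) (A ⟨x, hxd⟩ - l • x) = A ⟨x, hxd⟩ - l • x := by
        rw [← h.apply_proj_sub_smul hA.dense_domain measurableSet_Icc l ⟨x, hxd⟩]
        exact congrArg (fun v : A.domain => A v - l • (v : K)) (Subtype.ext hx)
      have h1 := ih _ hy
      have h2 := h.norm_apply_sub_le hA hr0 ⟨x, hxd⟩ hx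
      have h3 := h'.mul_norm_le_norm_apply_sub hIic (l := l) (r := l)
        (fun t ht => by rw [sub_self]; exact ht)
        ⟨_, h'.proj_mem_domain hIic hJd⟩ (E'.proj_proj hIic _)
      rw [h'.apply_proj_sub_smul hA'.dense_domain hIic l ⟨J x, hJd⟩, hJx, ← map_smul,
        ← map_sub] at h3
      calc l ^ (n + 1) * ‖E'.proj (Set.Iic 0) (J x)‖
          = l ^ n * (l * ‖E'.proj (Set.Iic 0) (J x)‖) := by ring
        _ ≤ l ^ n * ‖E'.proj (Set.Iic 0) (J (A ⟨x, hxd⟩ - l • x))‖ :=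
            mul_le_mul_of_nonneg_left h3 (pow_nonneg (hr0.trans hlr).le n)
        _ ≤ _ := h1
        _ ≤ ‖E'.proj (Set.Iic 0)‖ * (‖J‖ * (r ^ n * (r * ‖x‖))) := by gcongr
        _ = _ := by ring
  have hl0 := hr0.trans hlr
  have hlim : Filter.Tendsto
      (fun n : ℕ => ‖E'.proj (Set.Iic 0)‖ * (‖J‖ * ((r / l) ^ n * ‖x‖))) Filter.atTop (nhds 0) := by
    have h1 := tendsto_pow_atTop_nhds_zero_of_lt_one (div_pos hr0 hl0).le ((div_lt_one hl0).mpr hlr)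
    simpa using ((h1.mul_const ‖x‖).const_mul ‖J‖).const_mul ‖E'.proj (Set.Iic 0)‖
  refine norm_le_zero_iff.mp (ge_of_tendsto' hlim fun n => ?_)
  have h1 := key n x hx
  rw [mul_comm, ← le_div_iff₀ (pow_pos hl0 n)] at h1
  refine h1.trans (le_of_eq ?_)
  rw [div_pow]
  ring

theorem proj_Iic_intertwine (h : IsSpectralMeasure A E) (h' : IsSpectralMeasure A' E')
    (hA : IsSelfAdjoint A) (hA' : IsSelfAdjoint A')
    (hJ : ∀ x : A.domain, ∃ hx : J x ∈ A'.domain, A' ⟨J x, hx⟩ = J (A x)) (x : K) :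
    E'.proj (Set.Iic 0) (J (E.proj (Set.Ioi 0) x)) = 0 := by
  have hlim := (((E'.proj (Set.Iic 0)).continuous.comp J.continuous).tendsto _).comp
    (E.tendsto_proj_Icc x)
  refine tendsto_nhds_unique hlim (tendsto_const_nhds.congr' ?_)
  -- for `n = 0` the interval is a point
  filter_upwards [Filter.eventually_gt_atTop 0] with n hn
  refine (h.proj_Iic_intertwine_of_Icc h' hA hA' hJ (by positivity) ?_
    (E.proj_proj measurableSet_Icc x)).symm
  have hn' : (0 : ℝ) < n := by exact_mod_cast hn
  exact ((div_lt_one (by positivity)).mpr (by linarith)).trans (by linarith)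

theorem proj_Ioi_eq_zero_of_apply_eq_zero (h : IsSpectralMeasure A E)
    (hd : Dense (A.domain : Set K)) (x : A.domain) (hx : A x = 0) :
    E.proj (Set.Ioi 0) x = 0 := by
  refine tendsto_nhds_unique (E.tendsto_proj_Icc x) (tendsto_const_nhds.congr fun n => ?_)
  have hB : MeasurableSet (Set.Icc (1 / ((n : ℝ) + 1)) (n + 1)) := measurableSet_Icc
  have h1 := h.mul_norm_sq_le_inner hB (fun t ht => ht.1) ⟨_, h.proj_mem_domain hB x.2⟩
    (E.proj_proj hB x)
  rw [h.apply_proj hd hB, hx, map_zero, inner_zero_right, Complex.zero_re] at h1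
  have h2 : ‖E.proj (Set.Icc (1 / ((n : ℝ) + 1)) (n + 1)) x‖ ^ 2 ≤ 0 :=
    nonpos_of_mul_nonpos_right h1 (by positivity)
  have h3 := le_antisymm h2 (by positivity)
  exact (norm_eq_zero.mp ((pow_eq_zero_iff two_ne_zero).mp h3)).symm

/-- On the range of `E({0})` the operator vanishes. -/
theorem apply_proj_singleton_zero (h : IsSpectralMeasure A E) (hA : IsSelfAdjoint A) (x : K) :
    ∃ hx : E.proj {0} x ∈ A.domain, A ⟨E.proj {0} x, hx⟩ = 0 := by
  have hB : MeasurableSet ({0} : Set ℝ) := measurableSet_singleton 0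
  have hd := h.mem_domain_of_subset_Icc hB (a := 0) (b := 0) (by simp) (E.proj_proj hB x)
  refine ⟨hd, norm_le_zero_iff.mp ?_⟩
  have h1 : ∀ r : ℝ, 0 < r → ‖A ⟨E.proj {0} x, hd⟩‖ ≤ r * ‖E.proj {0} x‖ := fun r hr => by
    have h2 := h.norm_apply_sub_le hA (l := 0) hr ⟨_, hd⟩ (by
      change E.proj _ (E.proj {0} x) = E.proj {0} x
      rw [E.proj_proj_inter measurableSet_Icc hB, Set.inter_eq_right.mpr]
      simpa using hr.le)
    simpa using h2
  have h3 : Filter.Tendsto (fun r : ℝ => r * ‖E.proj {0} x‖) (nhdsWithin 0 (Set.Ioi 0))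
      (nhds 0) := by
    have : Filter.Tendsto (fun r : ℝ => r * ‖E.proj {0} x‖) (nhds 0)
      (nhds (0 * ‖E.proj {0} x‖)) := (continuous_id.mul continuous_const).tendsto _
    rw [zero_mul] at this
    exact this.mono_left nhdsWithin_le_nhds
  exact ge_of_tendsto h3 (Filter.eventually_of_mem self_mem_nhdsWithin h1)

/-- A bounded real-linear map intertwining two selfadjoint operators intertwines their spectral
projections for `(0, ∞)` and for `{0}`. The map need not be unitary, so that this covers both the
uniqueness of these projections (`J = 1`) and antilinear similarities. -/
theorem proj_intertwine (h : IsSpectralMeasure A E) (h' : IsSpectralMeasure A' E')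
    (hA : IsSelfAdjoint A) (hA' : IsSelfAdjoint A')
    (hJ : ∀ x : A.domain, ∃ hx : J x ∈ A'.domain, A' ⟨J x, hx⟩ = J (A x)) (x : K) :
    E'.proj (Set.Ioi 0) (J x) = J (E.proj (Set.Ioi 0) x) ∧
      E'.proj {0} (J x) = J (E.proj {0} x) := by
  have hneg : ∀ x : (-A).domain, ∃ hx : J x ∈ (-A').domain, (-A') ⟨J x, hx⟩ = J ((-A) x) :=
    fun x => by
      obtain ⟨hx, hx'⟩ := hJ x
      refine ⟨hx, ?_⟩
      rw [LinearPMap.neg_apply, LinearPMap.neg_apply, map_neg]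
      exact congrArg _ hx'
  -- the three spectral subspaces are mapped into one another
  have hp := h.proj_Iic_intertwine h' hA hA' hJ x
  have hn := h.reflect.proj_Iic_intertwine h'.reflect hA.neg_pmap hA'.neg_pmap hneg x
  rw [E.reflect_proj, E'.reflect_proj] at hn
  simp only [Set.neg_Iic, Set.neg_Ioi, neg_zero] at hn
  obtain ⟨hzd, hz⟩ := h.apply_proj_singleton_zero hA x
  obtain ⟨hzd', hz'⟩ := hJ ⟨_, hzd⟩
  rw [hz, map_zero] at hz'
  have hz1 := h'.proj_Ioi_eq_zero_of_apply_eq_zero hA'.dense_domain _ hz'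
  have hz2 := h'.reflect.proj_Ioi_eq_zero_of_apply_eq_zero hA'.neg_pmap.dense_domain ⟨_, hzd'⟩ (by
    rw [LinearPMap.neg_apply, neg_eq_zero]; exact hz')
  rw [E'.reflect_proj] at hz2
  simp only [Set.neg_Ioi, neg_zero] at hz1 hz2
  have m0 : MeasurableSet ({0} : Set ℝ) := measurableSet_singleton 0
  have hp1 := E'.proj_eq_zero_of_subset m0 measurableSet_Iic (by simp) hp
  have hp2 := E'.proj_eq_zero_of_subset measurableSet_Iio measurableSet_Iic
    Set.Iio_subset_Iic_self hp
  have hn1 := E'.proj_eq_zero_of_subset m0 measurableSet_Ici (by simp) hn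
  have hn2 := E'.proj_eq_zero_of_subset measurableSet_Ioi measurableSet_Ici
    Set.Ioi_subset_Ici_self hn
  have hx := congrArg J (E.proj_Ioi_add_proj_singleton_add_proj_Iio x)
  have hp3 := E'.proj_Ioi_add_proj_singleton_add_proj_Iio (J (E.proj (Set.Ioi 0) x))
  have hz3 := E'.proj_Ioi_add_proj_singleton_add_proj_Iio (J (E.proj {0} x))
  rw [hp1, hp2, add_zero, add_zero] at hp3
  rw [hz1, hz2, zero_add, add_zero] at hz3
  rw [map_add, map_add] at hx
  constructor
  · rw [← hx, map_add, map_add, hp3, hz1, hn2, add_zero, add_zero]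
  · rw [← hx, map_add, map_add, hp1, hz3, hn1, zero_add, add_zero]

end IsSpectralMeasure
end

/-! ### The measures of a representation of `C(X)` -/

noncomputable section

namespace StarRep

open Filter Topology
open scoped ENNReal

variable {X : Type*} [MetricSpace X]
  {K : Type*} [NormedAddCommGroup K] [InnerProductSpace ℂ K] [CompleteSpace K]
  (Φ : C(X, ℂ) →⋆ₐ[ℂ] (K →L[ℂ] K))

theorem inner_apply_left (f : C(X, ℂ)) (x y : K) : ⟪Φ f x, y⟫_ℂ = ⟪x, Φ (star f) y⟫_ℂ := by
  rw [map_star, ContinuousLinearMap.star_eq_adjoint, ContinuousLinearMap.adjoint_inner_right]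

theorem mul_apply (f g : C(X, ℂ)) (x : K) : Φ (f * g) x = Φ f (Φ g x) := by
  rw [map_mul]; rfl

/-- A real continuous function regarded as a complex one. -/
def ofRealMap (f : C(X, ℝ)) : C(X, ℂ) := ⟨fun t => (f t : ℂ), by fun_prop⟩

theorem ofReal_re_inner (f : C(X, ℝ)) (x : K) :
    (((⟪x, Φ (ofRealMap f) x⟫_ℂ).re : ℝ) : ℂ) = ⟪x, Φ (ofRealMap f) x⟫_ℂ := by
  rw [← Complex.conj_eq_iff_re, inner_conj_symm, inner_apply_left]
  congr 3
  ext t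
  simp [ofRealMap]

variable [CompactSpace X] [MeasurableSpace X] [BorelSpace X]

/-- The functional `f ↦ ⟪x, Φ(f) x⟫` is positive, hence given by a finite measure. -/
theorem exists_measure (x : K) : ∃ μ : Measure X, IsFiniteMeasure μ ∧
    ∀ f : C(X, ℂ), ⟪x, Φ f x⟫_ℂ = ∫ t, f t ∂μ := by
  let L : CompactlySupportedContinuousMap X ℝ →ₗ[ℝ] ℝ :=
    { toFun := fun f => (⟪x, Φ (ofRealMap f.toContinuousMap) x⟫_ℂ).re
      map_add' := fun f g => by
        rw [← Complex.add_re, ← inner_add_right, ← add_apply, ← map_add]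
        congr 5
        ext t
        simp [ofRealMap]
      map_smul' := fun c f => by
        have : ofRealMap (c • f).toContinuousMap = (c : ℂ) • ofRealMap f.toContinuousMap := by
          ext t
          simp [ofRealMap]
        rw [this, map_smul, smul_apply, inner_smul_right,
          Complex.re_ofReal_mul]
        rfl }
  have hL : ∀ f : CompactlySupportedContinuousMap X ℝ, 0 ≤ f → 0 ≤ L f := fun f hf => by
    -- a nonnegative function is the square of its real square root
    let g : C(X, ℂ) := ofRealMap ⟨fun t => Real.sqrt (f t), by fun_prop⟩
    have hg : ofRealMap f.toContinuousMap = star g * g := by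
      ext t
      have := Real.mul_self_sqrt (hf t)
      simp only [g, ofRealMap, ContinuousMap.coe_mk, ContinuousMap.mul_apply,
        ContinuousMap.star_apply, Complex.star_def, Complex.conj_ofReal, ← Complex.ofReal_mul, this]
      rfl
    change 0 ≤ (⟪x, Φ (ofRealMap f.toContinuousMap) x⟫_ℂ).re
    rw [hg, mul_apply, ← inner_apply_left]
    exact inner_self_nonneg (𝕜 := ℂ)
  let Λ := PositiveLinearMap.mk₀ L hL
  have hreal : ∀ f : C(X, ℝ), ⟪x, Φ (ofRealMap f) x⟫_ℂ =
      ((∫ t, f t ∂(RealRMK.rieszMeasure Λ) : ℝ) : ℂ) := fun f => by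
    have h := RealRMK.integral_rieszMeasure Λ (CompactlySupportedContinuousMap.continuousMapEquiv f)
    rw [← ofReal_re_inner]
    congr 1
    exact h.symm
  refine ⟨RealRMK.rieszMeasure Λ, inferInstance, fun f => ?_⟩
  let u : C(X, ℝ) := ⟨fun t => (f t).re, by fun_prop⟩
  let v : C(X, ℝ) := ⟨fun t => (f t).im, by fun_prop⟩
  have hf : f = ofRealMap u + Complex.I • ofRealMap v := by
    ext t
    simp [u, v, ofRealMap, mul_comm Complex.I, Complex.re_add_im]
  have hi : Integrable f (RealRMK.rieszMeasure Λ) :=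
    f.continuous.integrable_of_hasCompactSupport (HasCompactSupport.of_compactSpace _)
  rw [← integral_re_add_im hi]
  conv_lhs => rw [hf]
  rw [map_add, map_smul, add_apply, smul_apply,
    inner_add_right, inner_smul_right, hreal, hreal, mul_comm]
  rfl

/-- The measure `μ_x` on `X` with `⟪x, Φ(f) x⟫ = ∫ f dμ_x` for all continuous `f`. -/
def measure (x : K) : Measure X := (exists_measure Φ x).choose

instance (x : K) : IsFiniteMeasure (measure Φ x) := (exists_measure Φ x).choose_spec.1

theorem inner_eq_integral (f : C(X, ℂ)) (x : K) : ⟪x, Φ f x⟫_ℂ = ∫ t, f t ∂(measure Φ x) :=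
  (exists_measure Φ x).choose_spec.2 f

theorem memLp (f : C(X, ℂ)) (μ : Measure X) [IsFiniteMeasure μ] (p : ℝ≥0∞) : MemLp f p μ :=
  (f.continuous.memLp_top_of_hasCompactSupport (HasCompactSupport.of_compactSpace _) μ).mono_exponent
    le_top

theorem norm_sq_apply (f : C(X, ℂ)) (x : K) :
    ‖Φ f x‖ ^ 2 = ∫ t, ‖f t‖ ^ 2 ∂(measure Φ x) := by
  have h := inner_eq_integral Φ (star f * f) x
  rw [mul_apply, ← inner_apply_left, inner_self_eq_norm_sq_to_K] at h
  have h2 : ∀ t, (star f * f) t = ((‖f t‖ ^ 2 : ℝ) : ℂ) := fun t => by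
    simp [Complex.conj_mul']
  simp only [h2] at h
  rw [integral_complex_ofReal] at h
  refine Complex.ofReal_injective ?_
  rw [← h, Complex.ofReal_pow]
  rfl

/-- The map `f ↦ Φ(f) x` is isometric for the norm of `L²(μ_x)`. -/
theorem enorm_apply (f : C(X, ℂ)) (x : K) : ‖Φ f x‖ₑ = eLpNorm f 2 (measure Φ x) := by
  rw [(memLp f (measure Φ x) 2).eLpNorm_eq_integral_rpow_norm two_ne_zero ENNReal.ofNat_ne_top,
    ← ofReal_norm]
  congr 1
  simp only [ENNReal.toReal_ofNat, Real.rpow_two]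
  rw [← norm_sq_apply, ← one_div, ← Real.sqrt_eq_rpow, Real.sqrt_sq (norm_nonneg _)]

theorem exists_approx {g : X → ℂ} {ν : Measure X} [IsFiniteMeasure ν] (hg : MemLp g 2 ν) :
    ∃ f : ℕ → C(X, ℂ), Tendsto (fun n => eLpNorm (⇑(f n) - g) 2 ν) atTop (𝓝 0) := by
  have h (n : ℕ) := hg.exists_boundedContinuous_eLpNorm_sub_le (ENNReal.ofNat_ne_top)
    (ENNReal.inv_ne_zero.mpr (ENNReal.natCast_ne_top n))
  choose f hf _ using h
  refine ⟨fun n => (f n).toContinuousMap, ?_⟩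
  refine tendsto_of_tendsto_of_tendsto_of_le_of_le tendsto_const_nhds
    ENNReal.tendsto_inv_nat_nhds_zero (fun n => zero_le) fun n => ?_
  rw [eLpNorm_sub_comm]
  exact hf n

/-- The vector `Φ(g) x`, characterized by its distances to the vectors `Φ(f) x`. -/
theorem exists_extend {g : X → ℂ} {x : K} (hg : MemLp g 2 (measure Φ x)) :
    ∃ v : K, ∀ f : C(X, ℂ), ‖Φ f x - v‖ₑ = eLpNorm (⇑f - g) 2 (measure Φ x) := by
  obtain ⟨f, hf⟩ := exists_approx hg
  have hsub : ∀ f₁ f₂ : C(X, ℂ), edist (Φ f₁ x) (Φ f₂ x) =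
      edist ((memLp f₁ (measure Φ x) 2).toLp f₁) ((memLp f₂ (measure Φ x) 2).toLp f₂) :=
    fun f₁ f₂ => by
      rw [Lp.edist_toLp_toLp, edist_eq_enorm_sub, ← sub_apply, ← map_sub,
        enorm_apply, ContinuousMap.coe_sub]
  have hlim : Tendsto (fun n => (memLp (f n) (measure Φ x) 2).toLp (f n)) atTop
      (𝓝 (hg.toLp g)) := by
    rw [tendsto_iff_edist_tendsto_0]
    simpa only [Lp.edist_toLp_toLp] using hf
  have hc : CauchySeq fun n => Φ (f n) x := by
    have h := EMetric.cauchySeq_iff.mp hlim.cauchySeq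
    refine EMetric.cauchySeq_iff.mpr fun ε hε => ?_
    obtain ⟨N, hN⟩ := h ε hε
    exact ⟨N, fun m hm n hn => (hsub _ _).trans_lt (hN m hm n hn)⟩
  obtain ⟨v, hv⟩ := cauchySeq_tendsto_of_complete hc
  refine ⟨v, fun k => ?_⟩
  rw [← edist_eq_enorm_sub, ← Lp.edist_toLp_toLp k g (memLp k _ 2) hg]
  refine tendsto_nhds_unique (tendsto_const_nhds.edist hv) ?_
  simp only [hsub]
  exact tendsto_const_nhds.edist hlim

open Classical in
/-- The vector `Φ(g) x` for `g ∈ L²(μ_x)`, the limit of `Φ(f) x` along continuous functions `f`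
tending to `g` in `L²(μ_x)` (and `0` for other `g`). -/
def extend (g : X → ℂ) (x : K) : K :=
  if h : MemLp g 2 (measure Φ x) then (exists_extend Φ h).choose else 0

variable {Φ} {g g' : X → ℂ} {x y : K}

/-- The defining property of `Φ(g) x`. -/
theorem enorm_apply_sub_extend (hg : MemLp g 2 (measure Φ x)) (f : C(X, ℂ)) :
    ‖Φ f x - extend Φ g x‖ₑ = eLpNorm (⇑f - g) 2 (measure Φ x) := by
  rw [extend, dif_pos hg]
  exact (exists_extend Φ hg).choose_spec f

theorem enorm_extend (hg : MemLp g 2 (measure Φ x)) :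
    ‖extend Φ g x‖ₑ = eLpNorm g 2 (measure Φ x) := by
  have h := enorm_apply_sub_extend hg 0
  rwa [map_zero, zero_apply, zero_sub, enorm_neg, ContinuousMap.coe_zero,
    zero_sub, eLpNorm_neg] at h

theorem tendsto_extend {ν : Measure X} (hg : MemLp g 2 ν) (hν : measure Φ x ≤ ν)
    {f : ℕ → C(X, ℂ)} (hf : Tendsto (fun n => eLpNorm (⇑(f n) - g) 2 ν) atTop (𝓝 0)) :
    Tendsto (fun n => Φ (f n) x) atTop (𝓝 (extend Φ g x)) := by
  rw [tendsto_iff_edist_tendsto_0]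
  refine tendsto_of_tendsto_of_tendsto_of_le_of_le tendsto_const_nhds hf (fun n => zero_le)
    fun n => ?_
  rw [edist_eq_enorm_sub, enorm_apply_sub_extend (hg.mono_measure hν)]
  exact eLpNorm_mono_measure _ hν

theorem eq_extend (hg : MemLp g 2 (measure Φ x)) {f : ℕ → C(X, ℂ)} {v : K}
    (hf : Tendsto (fun n => eLpNorm (⇑(f n) - g) 2 (measure Φ x)) atTop (𝓝 0))
    (hv : Tendsto (fun n => Φ (f n) x) atTop (𝓝 v)) : v = extend Φ g x :=
  tendsto_nhds_unique hv (tendsto_extend hg le_rfl hf)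

theorem extend_coe (f : C(X, ℂ)) (x : K) : extend Φ f x = Φ f x := by
  have h := enorm_apply_sub_extend (memLp f (measure Φ x) 2) f
  rw [sub_self, eLpNorm_zero, enorm_eq_zero, sub_eq_zero] at h
  exact h.symm

theorem extend_congr (hg : MemLp g 2 (measure Φ x)) (h : g =ᵐ[measure Φ x] g') :
    extend Φ g x = extend Φ g' x := by
  obtain ⟨f, hf⟩ := exists_approx hg
  refine eq_extend (hg.ae_eq h) (f := f) (hf.congr fun n => ?_) (tendsto_extend hg le_rfl hf)
  exact eLpNorm_congr_ae (Filter.EventuallyEq.rfl.sub h)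

theorem extend_add_fun (hg : MemLp g 2 (measure Φ x)) (hg' : MemLp g' 2 (measure Φ x)) :
    extend Φ (g + g') x = extend Φ g x + extend Φ g' x := by
  obtain ⟨f, hf⟩ := exists_approx hg
  obtain ⟨f', hf'⟩ := exists_approx hg'
  refine (eq_extend (hg.add hg') (f := fun n => f n + f' n) ?_ ?_).symm
  · have h := hf.add hf'
    rw [add_zero] at h
    refine tendsto_of_tendsto_of_tendsto_of_le_of_le tendsto_const_nhds h (fun n => zero_le)
      fun n => ?_
    rw [ContinuousMap.coe_add, add_sub_add_comm]
    exact eLpNorm_add_le ((memLp (f n) _ 2).sub hg).1 ((memLp (f' n) _ 2).sub hg').1 (by norm_num)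
  · simp only [map_add, add_apply]
    exact (tendsto_extend hg le_rfl hf).add (tendsto_extend hg' le_rfl hf')

theorem tendsto_extend_extend {u : ℕ → X → ℂ} (hg : MemLp g 2 (measure Φ x))
    (hu : ∀ n, MemLp (u n) 2 (measure Φ x))
    (h : Tendsto (fun n => eLpNorm (u n - g) 2 (measure Φ x)) atTop (𝓝 0)) :
    Tendsto (fun n => extend Φ (u n) x) atTop (𝓝 (extend Φ g x)) := by
  rw [tendsto_iff_edist_tendsto_0]
  refine h.congr fun n => ?_
  rw [edist_eq_enorm_sub, ← enorm_extend ((hu n).sub hg)]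
  congr 1
  rw [eq_sub_iff_add_eq, ← extend_add_fun ((hu n).sub hg) hg, sub_add_cancel]

/-- Continuous functions act on the vectors `Φ(g) x` by multiplication of `g`. -/
theorem apply_extend (k : C(X, ℂ)) (hg : MemLp g 2 (measure Φ x)) :
    Φ k (extend Φ g x) = extend Φ (k * g) x := by
  obtain ⟨f, hf⟩ := exists_approx hg
  have hk : MemLp (⇑k * g) 2 (measure Φ x) := hg.mul (memLp k _ ∞)
  refine eq_extend hk (f := fun n => k * f n) ?_ ?_
  · have h := ENNReal.Tendsto.const_mul hf (a := (‖k‖₊ : ℝ≥0∞)) (Or.inr ENNReal.coe_ne_top)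
    rw [mul_zero] at h
    refine tendsto_of_tendsto_of_tendsto_of_le_of_le tendsto_const_nhds h (fun n => zero_le)
      fun n => ?_
    refine eLpNorm_le_nnreal_smul_eLpNorm_of_ae_le_mul (ae_of_all _ fun t => ?_) 2
    rw [Pi.sub_apply, Pi.sub_apply, ContinuousMap.mul_apply, Pi.mul_apply, ← mul_sub, nnnorm_mul]
    gcongr
    exact k.norm_coe_le_norm t
  · simp only [mul_apply]
    exact ((Φ k).continuous.tendsto _).comp (tendsto_extend hg le_rfl hf)

theorem extend_add (hg : ∀ (ν : Measure X) [IsFiniteMeasure ν], MemLp g 2 ν) (x y : K) :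
    extend Φ g (x + y) = extend Φ g x + extend Φ g y := by
  have hν : MemLp g 2 (measure Φ (x + y) + (measure Φ x + measure Φ y)) :=
    hg _
  obtain ⟨f, hf⟩ := exists_approx hν
  refine tendsto_nhds_unique (tendsto_extend hν (Measure.le_add_right le_rfl) hf) ?_
  simp only [map_add]
  exact (tendsto_extend hν (Measure.le_add_left (Measure.le_add_right le_rfl)) hf).add
    (tendsto_extend hν (Measure.le_add_left (Measure.le_add_left le_rfl)) hf)

theorem extend_smul (hg : ∀ (ν : Measure X) [IsFiniteMeasure ν], MemLp g 2 ν) (c : ℂ) (x : K) :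
    extend Φ g (c • x) = c • extend Φ g x := by
  have hν : MemLp g 2 (measure Φ (c • x) + measure Φ x) := hg _
  obtain ⟨f, hf⟩ := exists_approx hν
  refine tendsto_nhds_unique (tendsto_extend hν (Measure.le_add_right le_rfl) hf) ?_
  simp only [map_smul]
  exact (tendsto_extend hν (Measure.le_add_left le_rfl) hf).const_smul c

theorem inner_extend_left (hg : ∀ (ν : Measure X) [IsFiniteMeasure ν], MemLp g 2 ν) (x y : K) :
    ⟪extend Φ g x, y⟫_ℂ = ⟪x, extend Φ (star g) y⟫_ℂ := by
  have hν : MemLp g 2 (measure Φ x + measure Φ y) := hg _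
  obtain ⟨f, hf⟩ := exists_approx hν
  refine tendsto_nhds_unique ((tendsto_extend hν (Measure.le_add_right le_rfl) hf).inner
    tendsto_const_nhds) ?_
  simp only [inner_apply_left]
  refine tendsto_const_nhds.inner (tendsto_extend (ν := measure Φ x + measure Φ y) hν.star
    (Measure.le_add_left le_rfl) (hf.congr fun n => ?_))
  rw [ContinuousMap.coe_star, ← star_sub]
  exact eLpNorm_congr_norm_ae (ae_of_all _ fun t => by rw [Pi.star_apply, norm_star])

/-- The measure of `Φ(k) x` has density `|k|²` with respect to that of `x`. -/
theorem measure_apply (k : C(X, ℂ)) (x : K) :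
    measure Φ (Φ k x) = (measure Φ x).withDensity fun t => ((‖k t‖₊ ^ 2 : NNReal) : ℝ≥0∞) := by
  have hk : Measurable fun t => ‖k t‖₊ ^ 2 := by fun_prop
  have hfin : IsFiniteMeasure
      ((measure Φ x).withDensity fun t => ((‖k t‖₊ ^ 2 : NNReal) : ℝ≥0∞)) := by
    refine isFiniteMeasure_withDensity (ne_of_lt ?_)
    calc ∫⁻ t, ((‖k t‖₊ ^ 2 : NNReal) : ℝ≥0∞) ∂(measure Φ x)
        ≤ ∫⁻ _t, ((‖k‖₊ ^ 2 : NNReal) : ℝ≥0∞) ∂(measure Φ x) := by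
          refine lintegral_mono fun t => ?_
          gcongr
          exact k.norm_coe_le_norm t
      _ < ∞ := by
          rw [lintegral_const]
          exact ENNReal.mul_lt_top ENNReal.coe_lt_top (measure_lt_top _ _)
  refine ext_of_forall_integral_eq_of_IsFiniteMeasure fun f => ?_
  rw [integral_withDensity_eq_integral_smul hk, ← Complex.ofReal_inj, ← integral_complex_ofReal,
    ← integral_complex_ofReal]
  have h1 := inner_eq_integral Φ (ofRealMap f.toContinuousMap) (Φ k x)
  have h2 := inner_eq_integral Φ (star k * (ofRealMap f.toContinuousMap * k)) x
  rw [mul_apply, mul_apply, ← inner_apply_left, h1] at h2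
  refine h2.trans (integral_congr_ae (ae_of_all _ fun t => ?_))
  simp only [ContinuousMap.mul_apply, ContinuousMap.star_apply, ofRealMap, ContinuousMap.coe_mk,
    NNReal.smul_def, smul_eq_mul, NNReal.coe_pow, coe_nnnorm, Complex.star_def]
  rw [mul_left_comm, Complex.conj_mul']
  push_cast
  exact mul_comm _ _

end StarRep
end

/-! ### The projection-valued measure of a representation of `C(X)` -/

noncomputable section

namespace StarRep

open Filter Topology
open scoped ENNReal

variable {X : Type*} [MeasurableSpace X]

/-- The indicator function of `S`, with values in `ℂ`. -/
abbrev ind (S : Set X) : X → ℂ := S.indicator fun _ => 1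

variable {S S' : Set X}

theorem memLp_ind (hS : MeasurableSet S) (ν : Measure X) [IsFiniteMeasure ν] :
    MemLp (ind S) 2 ν :=
  memLp_indicator_const 2 hS 1 (Or.inr (measure_ne_top _ _))

variable [MetricSpace X] [CompactSpace X] [BorelSpace X]
  {K : Type*} [NormedAddCommGroup K] [InnerProductSpace ℂ K] [CompleteSpace K]
  (Φ : C(X, ℂ) →⋆ₐ[ℂ] (K →L[ℂ] K))

theorem norm_extend_ind_sq (hS : MeasurableSet S) (x : K) :
    ‖extend Φ (ind S) x‖ ^ 2 = (measure Φ x).real S := by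
  have h := enorm_extend (Φ := Φ) (x := x) (memLp_ind hS _)
  rw [eLpNorm_indicator_const hS two_ne_zero ENNReal.ofNat_ne_top] at h
  have h2 := congrArg (fun r => (r ^ (2 : ℝ)).toReal) h
  simp only [enorm_one, one_mul, ENNReal.toReal_ofNat] at h2
  rw [← ENNReal.rpow_mul] at h2
  norm_num at h2
  simpa [Measure.real] using h2

theorem extend_ind_extend_ind (hS : MeasurableSet S) (x : K) :
    extend Φ (ind S) (extend Φ (ind S) x) = extend Φ (ind S) x := by
  set y := extend Φ (ind S) x with hy
  obtain ⟨f, hf⟩ := exists_approx (memLp_ind hS (measure Φ x + measure Φ y))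
  refine tendsto_nhds_unique (tendsto_extend (memLp_ind hS _) (Measure.le_add_left le_rfl) hf) ?_
  have h1 : ∀ n, Φ (f n) y = extend Φ (⇑(f n) * ind S) x := fun n =>
    apply_extend (f n) (memLp_ind hS _)
  simp only [h1]
  refine tendsto_extend_extend (memLp_ind hS _)
    (fun n => (memLp_ind hS _).mul (memLp (f n) _ ∞)) ?_
  refine tendsto_of_tendsto_of_tendsto_of_le_of_le tendsto_const_nhds hf (fun n => zero_le)
    fun n => ?_
  refine (eLpNorm_mono fun t => ?_).trans (eLpNorm_mono_measure _ (Measure.le_add_right le_rfl))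
  by_cases ht : t ∈ S <;> simp [ht]

/-- The orthogonal projection `Φ(1_S)`. -/
def proj (S : Set X) (hS : MeasurableSet S) : K →L[ℂ] K :=
  LinearMap.mkContinuous
    { toFun := extend Φ (ind S)
      map_add' := extend_add fun ν _ => memLp_ind hS ν
      map_smul' := extend_smul fun ν _ => memLp_ind hS ν } 1 fun x => by
    have h : ‖extend Φ (ind S) x‖ₑ ≤ ‖x‖ₑ := by
      have h1 := enorm_apply Φ 1 x
      rw [map_one, one_apply_eq_self] at h1
      rw [enorm_extend (memLp_ind hS _), h1]
      refine eLpNorm_mono fun t => ?_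
      by_cases ht : t ∈ S <;> simp [ht]
    rw [one_mul]
    exact enorm_le_iff_norm_le.mp h

theorem proj_apply (hS : MeasurableSet S) (x : K) : proj Φ S hS x = extend Φ (ind S) x := rfl

theorem isStarProjection_proj (hS : MeasurableSet S) : IsStarProjection (proj Φ S hS) := by
  refine ⟨ContinuousLinearMap.ext fun x => extend_ind_extend_ind Φ hS x, ?_⟩
  rw [ContinuousLinearMap.isSelfAdjoint_iff_isSymmetric]
  intro x y
  change ⟪extend Φ (ind S) x, y⟫_ℂ = ⟪x, extend Φ (ind S) y⟫_ℂ
  rw [inner_extend_left fun ν _ => memLp_ind hS ν]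
  congr 2
  ext t
  by_cases ht : t ∈ S <;> simp [ht]

theorem extend_ind_union (hS : MeasurableSet S) (hS' : MeasurableSet S') (hd : Disjoint S S')
    (x : K) : extend Φ (ind (S ∪ S')) x = extend Φ (ind S) x + extend Φ (ind S') x := by
  rw [← extend_add_fun (memLp_ind hS _) (memLp_ind hS' _), ind,
    Set.indicator_union_of_disjoint hd]
  rfl

theorem extend_ind_biUnion {S : ℕ → Set X} (hS : ∀ n, MeasurableSet (S n))
    (hd : Pairwise (Function.onFun Disjoint S)) (s : Finset ℕ) (x : K) :
    extend Φ (ind (⋃ n ∈ s, S n)) x = ∑ n ∈ s, extend Φ (ind (S n)) x := by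
  induction s using Finset.induction_on with
  | empty =>
    have h := norm_extend_ind_sq Φ MeasurableSet.empty x
    simpa using h
  | insert a s ha ih =>
    rw [Finset.sum_insert ha, ← ih, Finset.set_biUnion_insert,
      extend_ind_union Φ (hS a) (Finset.measurableSet_biUnion s fun n _ => hS n)]
    refine Set.disjoint_iUnion₂_right.mpr fun n hn => hd fun h => ha (h ▸ hn)

theorem hasSum_extend_ind {S : ℕ → Set X} (hS : ∀ n, MeasurableSet (S n))
    (hd : Pairwise (Function.onFun Disjoint S)) (x : K) :
    HasSum (fun n => extend Φ (ind (S n)) x) (extend Φ (ind (⋃ n, S n)) x) := by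
  have hU := MeasurableSet.iUnion hS
  have hs (s : Finset ℕ) : MeasurableSet (⋃ n ∈ s, S n) :=
    Finset.measurableSet_biUnion s fun n _ => hS n
  have hsub (s : Finset ℕ) : ⋃ n ∈ s, S n ⊆ ⋃ n, S n :=
    Set.iUnion₂_subset fun n _ => Set.subset_iUnion S n
  have hdiff (s : Finset ℕ) : ‖extend Φ (ind (⋃ n, S n)) x - ∑ n ∈ s, extend Φ (ind (S n)) x‖ =
      Real.sqrt ((measure Φ x).real (⋃ n, S n) - ∑ n ∈ s, (measure Φ x).real (S n)) := by
    rw [← extend_ind_biUnion Φ hS hd, ← measureReal_biUnion_finset (fun i _ j _ hij => hd hij)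
      (fun n _ => hS n), ← measureReal_sdiff (hsub s) (hs s),
      ← norm_extend_ind_sq Φ (hU.diff (hs s)), Real.sqrt_sq (norm_nonneg _)]
    congr 1
    rw [sub_eq_iff_eq_add', ← extend_ind_union Φ (hs s) (hU.diff (hs s)) Set.disjoint_sdiff_right,
      Set.union_sdiff_cancel (hsub s)]
  have hsum : HasSum (fun n => (measure Φ x).real (S n)) ((measure Φ x).real (⋃ n, S n)) := by
    have hne : ∑' n, measure Φ x (S n) ≠ ∞ := by
      rw [← measure_iUnion hd hS]
      exact measure_ne_top _ _
    have h := ENNReal.hasSum_toReal hne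
    rwa [← ENNReal.tsum_toReal_eq fun n => measure_ne_top _ _, ← measure_iUnion hd hS] at h
  rw [HasSum, tendsto_iff_norm_sub_tendsto_zero]
  have h1 := (tendsto_const_nhds (x := (measure Φ x).real (⋃ n, S n))).sub hsum
  rw [sub_self] at h1
  have h2 := h1.sqrt
  rw [Real.sqrt_zero] at h2
  refine h2.congr fun s => ?_
  rw [← hdiff, norm_sub_rev]

open Classical in
/-- The image on `ℝ` of the projection-valued measure `S ↦ Φ(1_S)` under a measurable map `τ`. -/
def projectionValuedMeasure {τ : X → ℝ} (hτ : Measurable τ) : ProjectionValuedMeasure K where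
  proj B := if hB : MeasurableSet B then proj Φ (τ ⁻¹' B) (hτ hB) else 0
  isStarProjection B hB := by
    rw [dif_pos hB]
    exact isStarProjection_proj Φ _
  proj_univ := by
    rw [dif_pos MeasurableSet.univ]
    ext x
    have h : ind (Set.univ : Set X) = ⇑(1 : C(X, ℂ)) := by
      ext t; simp
    rw [proj_apply, Set.preimage_univ, h, extend_coe, map_one]
  hasSum_iUnion B hB hd x := by
    simp only [hB, MeasurableSet.iUnion hB, dif_pos, proj_apply, Set.preimage_iUnion]
    exact hasSum_extend_ind Φ (fun n => hτ (hB n)) (fun i j hij => (hd hij).preimage τ) x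

theorem scalarMeasure_projectionValuedMeasure {τ : X → ℝ} (hτ : Measurable τ) (x : K) :
    (projectionValuedMeasure Φ hτ).scalarMeasure x = (measure Φ x).map τ := by
  ext B hB
  rw [ProjectionValuedMeasure.scalarMeasure_apply _ hB, Measure.map_apply hτ hB]
  have : (projectionValuedMeasure Φ hτ).proj B x = extend Φ (ind (τ ⁻¹' B)) x := by
    simp only [projectionValuedMeasure, dif_pos hB, proj_apply]
  rw [this, norm_extend_ind_sq Φ (hτ hB), ofReal_measureReal]

end StarRep
end

/-! ### Existence of the spectral measure -/

noncomputable section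

section Existence

open StarRep

variable {K : Type*} [NormedAddCommGroup K] [InnerProductSpace ℂ K] [CompleteSpace K]
  {A : K →ₗ.[ℂ] K}

theorem IsSelfAdjoint.pmap_add_I_injective (hA : IsSelfAdjoint A) {x y : A.domain}
    (h : A x + Complex.I • (x : K) = A y + Complex.I • (y : K)) : x = y := by
  have h1 := hA.norm_sq_pmap_add_I (x - y)
  have h2 : A (x - y) + Complex.I • ((x - y : A.domain) : K) = 0 := by
    rw [LinearPMap.map_sub, Submodule.coe_sub, smul_sub, ← sub_eq_zero.mpr h]
    abel
  rw [h2, norm_zero] at h1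
  have h3 : ‖((x - y : A.domain) : K)‖ ^ 2 = 0 := by nlinarith [sq_nonneg ‖A (x - y)‖]
  have h4 : ((x - y : A.domain) : K) = 0 := by simpa using h3
  exact sub_eq_zero.mp (Subtype.ext h4)

/-- The resolvent `(A + i)⁻¹` of a selfadjoint operator as a bounded operator. -/
theorem IsSelfAdjoint.exists_resolvent (hA : IsSelfAdjoint A) : ∃ R : K →L[ℂ] K,
    (∀ y, ∃ h : R y ∈ A.domain, A ⟨R y, h⟩ + Complex.I • R y = y) ∧
    ∀ x : A.domain, R (A x + Complex.I • (x : K)) = x := by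
  choose r hr using hA.exists_pmap_add_I_eq
  have hadd : ∀ y z, r (y + z) = r y + r z := fun y z => hA.pmap_add_I_injective (by
    rw [hr, LinearPMap.map_add, Submodule.coe_add, smul_add, add_add_add_comm, hr, hr])
  have hsmul : ∀ (c : ℂ) y, r (c • y) = c • r y := fun c y => hA.pmap_add_I_injective (by
    rw [hr, LinearPMap.map_smul, Submodule.coe_smul, smul_comm, ← smul_add, hr])
  refine ⟨LinearMap.mkContinuous
    { toFun := fun y => (r y : K)
      map_add' := fun y z => by rw [hadd]; rfl
      map_smul' := fun c y => by rw [hsmul]; rfl } 1 fun y => ?_, fun y => ⟨(r y).2, hr y⟩,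
    fun x => congrArg Subtype.val (hA.pmap_add_I_injective (hr _))⟩
  have h := hA.norm_sq_pmap_add_I (r y)
  rw [hr] at h
  rw [one_mul]
  refine le_of_sq_le_sq ?_ (norm_nonneg y)
  rw [h]
  exact le_add_of_nonneg_left (sq_nonneg ‖A (r y)‖)

/-- The resolvent `R = (A + i)⁻¹` satisfies `R - R* = -2 i R R*` and is normal. -/
theorem IsSelfAdjoint.resolvent_apply (hA : IsSelfAdjoint A) {R : K →L[ℂ] K}
    (hR : ∀ y, ∃ h : R y ∈ A.domain, A ⟨R y, h⟩ + Complex.I • R y = y)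
    (hR' : ∀ x : A.domain, R (A x + Complex.I • (x : K)) = x) (u : K) :
    R u = star R u - (2 * Complex.I) • R (star R u) ∧ star R (R u) = R (star R u) := by
  -- The adjoint of `R` is `(A - i)⁻¹`.
  have hadj : ∀ w : A.domain, star R (A w - Complex.I • (w : K)) = w := fun w => by
    refine ext_inner_left ℂ fun y => ?_
    obtain ⟨hy, hy'⟩ := hR y
    rw [ContinuousLinearMap.star_eq_adjoint, ContinuousLinearMap.adjoint_inner_right]
    conv_rhs => rw [← hy']
    rw [inner_sub_right, inner_add_left, inner_smul_right, inner_smul_left, Complex.conj_I]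
    have := hA.inner_pmap_left ⟨R y, hy⟩ w
    rw [this]
    ring
  -- With `w = (A - i)⁻¹ u` and `p = R w`, the vector `(A - i) p = w - 2 i p` equals `R u`.
  obtain ⟨w, rfl⟩ := hA.exists_pmap_sub_I_eq u
  rw [hadj]
  obtain ⟨hp, hp'⟩ := hR w
  set p : A.domain := ⟨R w, hp⟩
  have hpw : A p - Complex.I • (p : K) = w - (2 * Complex.I) • (p : K) := by
    conv_rhs => rw [← hp']
    change A p - Complex.I • (p : K) = A p + Complex.I • (p : K) - (2 * Complex.I) • (p : K)
    module
  have h1 : R (A w - Complex.I • (w : K)) = (w : K) - (2 * Complex.I) • (p : K) := by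
    have h2 := hR' (w - (2 * Complex.I) • p)
    rw [LinearPMap.map_sub, LinearPMap.map_smul, Submodule.coe_sub, Submodule.coe_smul] at h2
    rw [← h2]
    congr 1
    have h3 : A p = (w : K) - Complex.I • (p : K) := eq_sub_of_add_eq hp'
    rw [h3]
    module
  exact ⟨h1, by rw [h1, ← hpw, hadj]⟩

theorem measurable_inv_re {X : Type*} [TopologicalSpace X] [MeasurableSpace X] [BorelSpace X]
    (ζ : C(X, ℂ)) : Measurable fun z => ((ζ z)⁻¹).re :=
  Complex.measurable_re.comp ζ.continuous.measurable.inv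

/-- If a representation of `C(X)` takes `ζ` to `(A + i)⁻¹`, where `ζ` has values on the circle
parametrized by `t ↦ (t + i)⁻¹`, then the spectral measure of `A` is the image of that of the
representation under `Re ζ⁻¹`. The zeros of `ζ`, where `Re ζ⁻¹` is a junk value, form a null set. -/
theorem IsSelfAdjoint.isSpectralMeasure_of_resolvent (hA : IsSelfAdjoint A) {R : K →L[ℂ] K}
    (hR : ∀ y, ∃ h : R y ∈ A.domain, A ⟨R y, h⟩ + Complex.I • R y = y)
    (hR' : ∀ x : A.domain, R (A x + Complex.I • (x : K)) = x)
    {X : Type*} [MetricSpace X] [CompactSpace X] [MeasurableSpace X] [BorelSpace X]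
    (Φ : C(X, ℂ) →⋆ₐ[ℂ] (K →L[ℂ] K)) {ζ : C(X, ℂ)} (hζ : Φ ζ = R)
    (hspec : ∀ z, (ζ z).im = -Complex.normSq (ζ z)) :
    IsSpectralMeasure A (projectionValuedMeasure Φ (measurable_inv_re ζ)) := by
  set τ : X → ℝ := fun z => ((ζ z)⁻¹).re
  have hτz : ∀ z : X, ζ z ≠ 0 → ζ z * ((τ z : ℂ) + Complex.I) = 1 :=
    fun z hz => by
      have h1 : ((τ z : ℂ) + Complex.I) = (ζ z)⁻¹ := by
        have hne : Complex.normSq (ζ z) ≠ 0 := by simpa using hz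
        apply Complex.ext
        · simp [τ]
        · rw [Complex.inv_im, hspec]
          simp [hne]
      rw [h1, mul_inv_cancel₀ hz]
  -- The zero set of `ζ` is null because `R` is injective.
  have hnull : ∀ x, ∀ᵐ z : X ∂(StarRep.measure Φ x), ζ z ≠ 0 := fun x => by
    have hS : MeasurableSet {z : X | ζ z = 0} :=
      measurableSet_eq_fun ζ.continuous.measurable measurable_const
    have h1 : R (extend Φ (ind {z : X | ζ z = 0}) x) = 0 := by
      rw [← hζ, apply_extend ζ (memLp_ind hS _)]
      have : ⇑ζ * ind {z : X | ζ z = 0} = ⇑(0 : C(X, ℂ)) := by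
        ext z
        by_cases hz : ζ z = 0 <;> simp [hz]
      rw [this, extend_coe, map_zero, zero_apply]
    obtain ⟨h2, h3⟩ := hR (extend Φ (ind {z : X | ζ z = 0}) x)
    have h4 : extend Φ (ind {z : X | ζ z = 0}) x = 0 := by
      rw [← h3]
      have : (⟨_, h2⟩ : A.domain) = 0 := Subtype.ext h1
      rw [this, h1, LinearPMap.map_zero, smul_zero, add_zero]
    have h5 := norm_extend_ind_sq Φ hS x
    rw [h4, norm_zero, zero_pow two_ne_zero] at h5
    rw [ae_iff]
    simpa using (measureReal_eq_zero_iff (measure_ne_top _ _)).mp h5.symm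
  have hsm := scalarMeasure_projectionValuedMeasure Φ (measurable_inv_re ζ)
  -- For `x = R y` the measure `μ_x` has density `|z|²` with respect to `μ_y`.
  have hdens : ∀ y, StarRep.measure Φ (R y) = _ := fun y => hζ ▸ measure_apply ζ y
  have hmeas : Measurable fun z => ‖ζ z‖₊ ^ 2 := by fun_prop
  have hinv : ∀ z : X, (‖ζ z‖₊ ^ 2) • τ z = (ζ z).re := fun z => by
    rw [NNReal.smul_def]
    simp only [τ, Complex.inv_re, NNReal.coe_pow, coe_nnnorm, smul_eq_mul, ← Complex.normSq_eq_norm_sq]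
    by_cases hz : ζ z = 0
    · simp [hz]
    · have hne : Complex.normSq (ζ z) ≠ 0 := by simpa using hz
      field_simp
  refine ⟨fun x => ?_, fun x => ?_⟩
  · rw [hsm, integrable_map_measure (by fun_prop) (measurable_inv_re ζ).aemeasurable]
    constructor
    · intro hx
      have hx' : R _ = x := hR' ⟨x, hx⟩
      rw [← hx', hdens, integrable_withDensity_iff_integrable_smul hmeas]
      refine Integrable.of_bound (by fun_prop) 1 (ae_of_all _ fun z => ?_)
      have h1 : (‖ζ z‖₊ ^ 2) • τ z ^ 2 = (ζ z).re * τ z := by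
        rw [← hinv, NNReal.smul_def, NNReal.smul_def, smul_eq_mul, smul_eq_mul]; ring
      change ‖(‖ζ z‖₊ ^ 2) • τ z ^ 2‖ ≤ 1
      rw [h1, Real.norm_eq_abs, abs_mul]
      by_cases hz : ζ z = 0
      · simp [hz]
      · calc |(ζ z).re| * |τ z| ≤ ‖ζ z‖ * ‖(ζ z)⁻¹‖ :=
              mul_le_mul (Complex.abs_re_le_norm _) (Complex.abs_re_le_norm _) (abs_nonneg _)
                (norm_nonneg _)
          _ = 1 := by rw [norm_inv, mul_inv_cancel₀ (norm_ne_zero_iff.mpr hz)]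
    -- If `τ ∈ L²(μ_x)`, then `x = R y` for the vector `y = Φ(τ + i) x`.
    · intro hx
      have hτ2 : MemLp τ 2 (StarRep.measure Φ x) :=
        (memLp_two_iff_integrable_sq (measurable_inv_re ζ).aestronglyMeasurable).mpr hx
      have hg : MemLp ((fun z => (τ z : ℂ)) + fun _ => Complex.I) 2 (StarRep.measure Φ x) :=
        (hτ2.ofReal (K := ℂ)).add (memLp_const _)
      have h1 : R (extend Φ ((fun z => (τ z : ℂ)) + fun _ => Complex.I) x) = x := by
        rw [← hζ, apply_extend ζ hg]
        rw [← extend_congr (g := ⇑(1 : C(X, ℂ))) (memLp 1 _ 2), extend_coe, map_one,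
          one_apply_eq_self]
        filter_upwards [hnull x] with z hz
        exact (hτz z hz).symm
      obtain ⟨h2, -⟩ := hR (extend Φ ((fun z => (τ z : ℂ)) + fun _ => Complex.I) x)
      rwa [h1] at h2
  · set y := A x + Complex.I • (x : K) with hy
    have hx : R y = x := hR' x
    rw [hsm, integral_map (measurable_inv_re ζ).aemeasurable (by fun_prop), ← hx, hdens,
      integral_withDensity_eq_integral_smul hmeas]
    have hint : ∫ z, (‖ζ z‖₊ ^ 2) • ((ζ z)⁻¹).re ∂(StarRep.measure Φ y) =
        ∫ z, (ζ z).re ∂(StarRep.measure Φ y) := integral_congr_ae (ae_of_all _ hinv)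
    rw [hint]
    have hre : ⟪(x : K), A x⟫_ℂ = (((⟪(x : K), A x⟫_ℂ).re : ℝ) : ℂ) :=
      Complex.ext rfl (by rw [hA.inner_pmap_self_im, Complex.ofReal_im])
    have h1 : (⟪(x : K), A x⟫_ℂ).re = (⟪y, R y⟫_ℂ).re := by
      rw [hx, hy, inner_add_left, inner_smul_left, hA.inner_pmap_left, inner_self_eq_norm_sq_to_K]
      simp [← Complex.ofReal_pow]
    rw [hx, hre, h1, ← hζ, inner_eq_integral]
    congr 1
    exact (integral_re (f := ⇑ζ) ((memLp ζ (StarRep.measure Φ y) 2).integrable one_le_two)).symm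

/-- Every selfadjoint operator has a spectral measure. -/
theorem IsSelfAdjoint.exists_isSpectralMeasure (hA : IsSelfAdjoint A) :
    ∃ E : ProjectionValuedMeasure K, IsSpectralMeasure A E := by
  obtain ⟨R, hR, hR'⟩ := hA.exists_resolvent
  have hcomm := hA.resolvent_apply hR hR'
  have hn : IsStarNormal R := ⟨ContinuousLinearMap.ext fun u => (hcomm u).2⟩
  let Φ := cfcHom (R := ℂ) hn
  let ζ : C(spectrum ℂ R, ℂ) := ContinuousMap.restrict (spectrum ℂ R) (ContinuousMap.id ℂ)
  have hζ : Φ ζ = R := cfcHom_id hn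
  have hζz : ∀ z, ζ z = (z : ℂ) := fun z => rfl
  -- The spectrum of `R` lies on the circle through `0` that `t ↦ (t + i)⁻¹` parametrizes.
  have hspec : ∀ z : spectrum ℂ R, (z : ℂ).im = -Complex.normSq z := fun z => by
    have h1 : Φ ζ = Φ (star ζ - (2 * Complex.I) • (ζ * star ζ)) := by
      rw [map_sub, map_smul, map_mul, map_star, hζ]
      exact ContinuousLinearMap.ext fun u => (hcomm u).1
    have h2 := DFunLike.congr_fun (cfcHom_injective hn h1) z
    simp only [ContinuousMap.sub_apply, ContinuousMap.smul_apply, ContinuousMap.mul_apply,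
      ContinuousMap.star_apply, hζz, Complex.star_def, Complex.mul_conj, smul_eq_mul] at h2
    have h3 := congrArg Complex.im h2
    simp at h3
    linarith
  exact ⟨_, hA.isSpectralMeasure_of_resolvent hR hR' Φ hζ hspec⟩

end Existence
end

/-! ### Conjugation and the Maxwell-type operator -/

noncomputable section

/-- The spectral projections of a selfadjoint operator are not junk values. -/
theorem IsSelfAdjoint.exists_spectralProjection_eq {K : Type*} [NormedAddCommGroup K] [InnerProductSpace ℂ K]
    [CompleteSpace K] {A : K →ₗ.[ℂ] K} (hA : IsSelfAdjoint A) :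
    ∃ E : ProjectionValuedMeasure K, IsSpectralMeasure A E ∧
      ∀ B, spectralProjection A B = E.proj B :=
  ⟨hA.exists_isSpectralMeasure.choose, hA.exists_isSpectralMeasure.choose_spec, fun B => by
    rw [spectralProjection, dif_pos hA.exists_isSpectralMeasure]⟩

namespace MaxwellTypeOperator

variable {H : Type*} [NormedAddCommGroup H] [InnerProductSpace ℂ H] [CompleteSpace H]
  (M : MaxwellTypeOperator H)

/-- The weighted norm is equivalent to the original one. -/
theorem exists_norm_bounds : ∃ a b : ℝ, 0 ≤ a ∧ 0 ≤ b ∧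
    (∀ x : M.WeightedSpace, ‖M.toH x‖ ≤ a * ‖x‖) ∧ ∀ x : M.WeightedSpace, ‖x‖ ≤ b * ‖M.toH x‖ := by
  obtain ⟨c, hc, h⟩ := M.bounded_below
  let S : H →L[ℂ] H := (M.WL.symm : H →L[ℂ] H) ∘L (M.WR : H →L[ℂ] H)
  have hsq : ∀ x : M.WeightedSpace, ‖x‖ ^ 2 = (⟪M.toH x, S (M.toH x)⟫_ℂ).re := fun x => by
    rw [← inner_self_eq_norm_sq (𝕜 := ℂ) x]; rfl
  refine ⟨Real.sqrt c⁻¹, Real.sqrt ‖S‖, Real.sqrt_nonneg _, Real.sqrt_nonneg _, fun x => ?_,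
    fun x => ?_⟩
  · refine le_of_sq_le_sq ?_ (by positivity)
    rw [mul_pow, Real.sq_sqrt (by positivity), inv_mul_eq_div, le_div_iff₀ hc, hsq, mul_comm]
    have h1 := h (M.toH x)
    rw [← M.symm_WR] at h1
    exact h1
  · refine le_of_sq_le_sq ?_ (by positivity)
    rw [mul_pow, Real.sq_sqrt (by positivity), hsq]
    calc (⟪M.toH x, S (M.toH x)⟫_ℂ).re ≤ ‖M.toH x‖ * ‖S (M.toH x)‖ :=
          (Complex.re_le_norm _).trans (norm_inner_le_norm _ _)
      _ ≤ ‖M.toH x‖ * (‖S‖ * ‖M.toH x‖) := by gcongr; exact S.le_opNorm _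
      _ = _ := by ring

theorem inner_WL_symm (x y : H) : ⟪M.WL.symm x, y⟫_ℂ = ⟪x, M.WL.symm y⟫_ℂ := by
  have h := M.isSelfAdjoint_WL.isSymmetric (M.WL.symm x) (M.WL.symm y)
  change ⟪M.WL (M.WL.symm x), M.WL.symm y⟫_ℂ = ⟪M.WL.symm x, M.WL (M.WL.symm y)⟫_ℂ at h
  rw [M.WL.apply_symm_apply, M.WL.apply_symm_apply] at h
  exact h.symm

theorem inner_WR (x y : H) : ⟪M.WR x, y⟫_ℂ = ⟪x, M.WR y⟫_ℂ :=
  M.isSelfAdjoint_WR.isSymmetric x y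

theorem toH_op (x : M.op.domain) : M.toH (M.op x) = M.WL (M.D ⟨M.WR (M.toH x), x.2⟩) := rfl

theorem mem_op_domain {x : M.WeightedSpace} :
    x ∈ M.op.domain ↔ M.WR (M.toH x) ∈ M.D.domain := Iff.rfl

/-- The weights cancel against the left factor: `⟪v, M x⟫_W = ⟪W_R v, D W_R x⟫`. -/
theorem inner_op (v : M.WeightedSpace) (x : M.op.domain) :
    ⟪v, M.op x⟫_ℂ = ⟪M.WR (M.toH v), M.D ⟨M.WR (M.toH x), x.2⟩⟫_ℂ := by
  rw [M.weighted_inner, M.toH_op, M.symm_WR, M.WL.symm_apply_apply, M.inner_WR]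

theorem dense_op_domain : Dense (M.op.domain : Set M.WeightedSpace) := by
  obtain ⟨a, b, ha, hb, h1, h2⟩ := M.exists_norm_bounds
  have hcont : Continuous (M.toH.symm : H → M.WeightedSpace) := by
    refine (LinearMap.mkContinuous (M.toH.symm : H →ₗ[ℂ] M.WeightedSpace) b fun x => ?_).continuous
    simpa using h2 (M.toH.symm x)
  have hc : Continuous fun x : H => M.toH.symm (M.WR.symm x) := hcont.comp M.WR.symm.continuous
  have hs : Function.Surjective fun x : H => M.toH.symm (M.WR.symm x) :=
    M.toH.symm.surjective.comp M.WR.symm.surjective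
  refine (hs.denseRange.dense_image hc M.isSelfAdjoint_D.dense_domain).mono ?_
  rintro _ ⟨x, hx, rfl⟩
  change M.WR (M.toH (M.toH.symm (M.WR.symm x))) ∈ M.D.domain
  simpa using hx

/-- The Maxwell-type operator is selfadjoint on the weighted space. -/
theorem isSelfAdjoint_op : IsSelfAdjoint M.op := by
  refine LinearPMap.isSelfAdjoint_of_forall M.dense_op_domain (fun x y => ?_) fun v w h => ?_
  · rw [← inner_conj_symm, M.inner_op, M.inner_op, inner_conj_symm]
    exact M.isSelfAdjoint_D.inner_pmap_left ⟨M.WR (M.toH x), x.2⟩ ⟨M.WR (M.toH y), y.2⟩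
  · refine (M.isSelfAdjoint_D.exists_pmap_eq (v := M.WR (M.toH v)) (w := M.WL.symm (M.toH w))
      fun z => ?_).1
    let x : M.op.domain := ⟨M.toH.symm (M.WR.symm z), by
      rw [mem_op_domain]; simp⟩
    have hx : M.WR (M.toH x) = z := by simp [x]
    have h1 := h x
    have hDx : (⟨M.WR (M.toH x), x.2⟩ : M.D.domain) = z := Subtype.ext hx
    rw [M.inner_op, hDx, M.weighted_inner, hx, ← M.inner_WL_symm] at h1
    exact h1

/-- Complex conjugation on `H_W` as a bounded real-linear map. It need not be isometric for the
weighted norm. -/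
def conjCLM : M.WeightedSpace →L[ℝ] M.WeightedSpace :=
  LinearMap.mkContinuousOfExistsBound
    { toFun := M.conj
      map_add' := fun x y => by simp only [conj, map_add]
      map_smul' := fun c x => by
        have h : M.C ((c : ℂ) • M.toH x) = (c : ℂ) • M.C (M.toH x) := by
          rw [LinearIsometryEquiv.map_smulₛₗ, Complex.conj_ofReal]
        change M.toH.symm (M.C (M.toH ((c : ℂ) • x))) = (c : ℂ) • M.toH.symm (M.C (M.toH x))
        rw [map_smul, h, map_smul] } (by
    obtain ⟨a, b, ha, hb, h1, h2⟩ := M.exists_norm_bounds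
    refine ⟨b * a, fun x => ?_⟩
    change ‖M.toH.symm (M.C (M.toH x))‖ ≤ _
    refine (h2 _).trans ?_
    rw [LinearEquiv.apply_symm_apply, LinearIsometryEquiv.norm_map, mul_assoc]
    gcongr
    exact h1 x)

theorem conjCLM_apply (x : M.WeightedSpace) : M.conjCLM x = M.conj x := rfl

theorem conj_conj (x : M.WeightedSpace) : M.conj (M.conj x) = x := by
  simp [conj, M.C_C]

/-- The relation `C M C = -M` on `H_W`, with its domain statement, in intertwining form. -/
theorem conj_op (x : M.op.domain) :
    ∃ hx : M.conjCLM x ∈ (-M.op).domain, (-M.op) ⟨M.conjCLM x, hx⟩ = M.conjCLM (M.op x) := by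
  have hx : M.C (M.toH x) ∈ (productOperator M.WL M.D M.WR).domain := by
    have : M.C (M.toH x) ∈ M.C '' ((productOperator M.WL M.D M.WR).domain : Set H) :=
      ⟨_, x.2, rfl⟩
    rwa [M.C_image_domain] at this
  refine ⟨hx, ?_⟩
  have h := M.C_anticommute ⟨M.C (M.toH x), hx⟩ ⟨M.toH x, x.2⟩ (M.C_C _).symm
  change -M.toH.symm (productOperator M.WL M.D M.WR ⟨M.C (M.toH x), hx⟩) =
    M.toH.symm (M.C (productOperator M.WL M.D M.WR ⟨M.toH x, x.2⟩))
  rw [h, map_neg]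

/-- Conjugation exchanges the positive and the negative spectral parts, which add up to `1`. -/
theorem Qplus_Qminus : (∀ x, M.Qplus x + M.Qminus x = x) ∧
    (∀ x, M.conj (M.Qplus x) = M.Qminus (M.conj x)) := by
  have hA := M.isSelfAdjoint_op
  obtain ⟨E, hE, hEp⟩ := hA.exists_spectralProjection_eq
  obtain ⟨E', hE', hEp'⟩ := hA.neg_pmap.exists_spectralProjection_eq
  -- uniqueness: the reflection of `E` agrees with `E'`
  have huniq := hE.reflect.proj_intertwine hE' hA.neg_pmap hA.neg_pmap
    (J := ContinuousLinearMap.id ℝ _) (fun x => ⟨x.2, rfl⟩)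
  have hconj := hE.proj_intertwine hE' hA hA.neg_pmap M.conj_op
  simp only [E.reflect_proj, Set.neg_Ioi, neg_zero, ContinuousLinearMap.id_apply,
    Set.neg_singleton, conjCLM_apply] at huniq hconj
  have hp (x) : M.Qplus x = E.proj (Set.Ioi 0) x + (1 / 2 : ℂ) • E.proj {0} x := by
    simp [Qplus, hEp]
  have hm (x) : M.Qminus x = E'.proj (Set.Ioi 0) x + (1 / 2 : ℂ) • E.proj {0} x := by
    simp [Qminus, hEp, hEp']
  refine ⟨fun x => ?_, fun x => ?_⟩
  · rw [hp, hm, (huniq x).1]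
    conv_rhs => rw [← E.proj_Ioi_add_proj_singleton_add_proj_Iio x]
    module
  · have hhalf : (1 / 2 : ℂ) = ((1 / 2 : ℝ) : ℂ) := by norm_num
    rw [hp, hm, (hconj x).1, ← (huniq (M.conj x)).2, (hconj x).2, ← conjCLM_apply, map_add, hhalf,
      Complex.coe_smul, map_smul, Complex.coe_smul]
    rfl

theorem conj_eq_of_mem_realWaves {u : M.WeightedSpace} (hu : u ∈ M.realWaves) : M.conj u = u := by
  have h : (1 / 2 : ℂ) • (u + M.conj u) = u := hu
  have h2 := congrArg (fun v => (2 : ℂ) • v - u) h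
  simp only [smul_smul] at h2
  norm_num at h2
  rw [h2]; module

theorem re_mem_realWaves (x : M.WeightedSpace) : M.re x ∈ M.realWaves := by
  have hhalf : (1 / 2 : ℂ) = ((1 / 2 : ℝ) : ℂ) := by norm_num
  have h : M.conj (M.re x) = M.re x := by
    rw [re, hhalf, Complex.coe_smul, ← conjCLM_apply, map_smul, map_add, conjCLM_apply,
      conjCLM_apply, conj_conj, add_comm]
  change (1 / 2 : ℂ) • (M.re x + M.conj (M.re x)) = M.re x
  rw [h]
  module

end MaxwellTypeOperator

end

theorem mainTheorem4 {H : Type*} [NormedAddCommGroup H] [InnerProductSpace ℂ H] [CompleteSpace H]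
    (M : MaxwellTypeOperator H) (Q : M.WeightedSpace →L[ℂ] M.WeightedSpace)
    (hQ : Q = M.Qplus ∨ Q = M.Qminus) :
    (∀ x : M.WeightedSpace, (2 : ℂ) • M.re (Q (M.re x)) = M.re x) ∧
    Set.BijOn Q M.realWaves (Q '' M.realWaves) ∧
    Set.InvOn (fun Ψ => (2 : ℂ) • M.re Ψ) Q M.realWaves (Q '' M.realWaves) := by
  have key : ∀ u ∈ M.realWaves, (2 : ℂ) • M.re (Q u) = u := fun u hu => by
    have hu' := M.conj_eq_of_mem_realWaves hu
    obtain ⟨hadd, hconj⟩ := M.Qplus_Qminus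
    have h2 : (2 : ℂ) • M.re (Q u) = Q u + M.conj (Q u) := by
      rw [MaxwellTypeOperator.re, smul_smul]
      norm_num
    rw [h2]
    rcases hQ with rfl | rfl
    · rw [hconj, hu', hadd]
    · have h3 := hconj u
      rw [hu'] at h3
      rw [← h3, M.conj_conj, h3, add_comm, hadd]
  have hinv : Set.LeftInvOn (fun Ψ => (2 : ℂ) • M.re Ψ) Q M.realWaves := key
  refine ⟨fun x => key _ (M.re_mem_realWaves x), hinv.injOn.bijOn_image, hinv, ?_⟩
  rintro _ ⟨u, hu, rfl⟩
  exact congrArg Q (key u hu)
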